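/- For $x,w\in\mathbb{R}$ let $T_xh(y)=h(y-x)$ and $M_wh(y)=e^{2\pi i w y}h(y)$. Fix a nonzero Schwartz function $\psi\in\mathcal{S}(\mathbb{R})$. For a tempered distribution $f$ let $V_\psi f(x,w)=\langle f,M_wT_x\psi\rangle$ be its short-time Fourier transform (the bracket is conjugate-linear in the second variable), and for $1\le q<\infty$ let $M^q(\mathbb{R})$ be the modulation space of all $f\in\mathcal{S}'(\mathbb{R})$ with $\|f\|_{M^q}=\|V_\psi f\|_{L^q(\mathbb{R}^2)}<\infty$. Call a pair of real numbers $(p,p_1)$ extensible if $1\le p\le 2$, $1\le p_1<\infty$ and $p_1<\frac{p}{2p-2}$, where the last bound is read as $\infty$ when $p=1$. Let $\alpha,\beta>0$, let $(p,p_1)$ be an extensible pair, and let $g,\gamma\in M^p(\mathbb{R})\ (\subseteq L^2(\mathbb{R}))$ be such that $\bigl(\{M_{\beta n}T_{\alpha k}g\}_{k,n\in\mathbb{Z}},\{M_{\beta n}T_{\alpha k}\gamma\}_{k,n\in\mathbb{Z}}\bigr)$ is a Schauder frame for $L^2(\mathbb{R})$, i.e. for some enumeration of $\mathbb{Z}^2$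 one has $h=\sum_{k,n}\langle h,M_{\beta n}T_{\alpha k}\gamma\rangle M_{\beta n}T_{\alpha k}g$ with convergence of the partial sums in $L^2(\mathbb{R})$ for every $h\in L^2(\mathbb{R})$. Then for every $f\in M^{p_1}(\mathbb{R})$ the pairings $\langle f,M_{\beta n}T_{\alpha k}\gamma\rangle$, understood as $\lim\langle f,\varphi\rangle$ for Schwartz functions $\varphi\to M_{\beta n}T_{\alpha k}\gamma$ in $M^p(\mathbb{R})$, are well defined, and $$f=\sum_{k,n\in\mathbb{Z}}\langle f,M_{\beta n}T_{\alpha k}\gamma\rangle\,M_{\beta n}T_{\alpha k}g$$ with unconditional convergence of the series in $M^{\frac{pp_1}{p+2p_1-2pp_1}}(\mathbb{R})$, i.e. for every enumeration of $\mathbb{Z}^2$ the partial sums converge to $f$ in the norm of that space. -/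

import Mathlib

open MeasureTheory Filter Topology
open scoped ENNReal SchwartzMap ComplexConjugate

/-- The character `y ↦ e^{2πiwy}`. -/
noncomputable def modChar (w : ℝ) (y : ℝ) : ℂ :=
  Complex.exp ((2 * Real.pi * w : ℝ) * Complex.I * y)

theorem modChar_norm (w y : ℝ) : ‖modChar w y‖ = 1 := by
  have h : ((2 * Real.pi * w : ℝ) : ℂ) * Complex.I * y
      = ((2 * Real.pi * w * y : ℝ) : ℂ) * Complex.I := by
    push_cast; ring
  rw [modChar, h, Complex.norm_exp_ofReal_mul_I]

theorem modChar_contDiff (w : ℝ) {n : WithTop ℕ∞} : ContDiff ℝ n (modChar w) := by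
  unfold modChar
  exact (contDiff_const.mul Complex.ofRealCLM.contDiff).cexp

theorem modChar_iteratedDeriv (w : ℝ) (n : ℕ) :
    iteratedDeriv n (modChar w)
      = fun y => (((2 * Real.pi * w : ℝ) : ℂ) * Complex.I) ^ n * modChar w y := by
  induction n with
  | zero => simp
  | succ n ih =>
    rw [iteratedDeriv_succ, ih]
    funext y
    have h1 : HasDerivAt (fun y : ℝ => ((2 * Real.pi * w : ℝ) : ℂ) * Complex.I * y)
        (((2 * Real.pi * w : ℝ) : ℂ) * Complex.I * 1) y :=
      (Complex.ofRealCLM.hasDerivAt (x := y)).const_mul _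
    have h2 := (h1.cexp).const_mul ((((2 * Real.pi * w : ℝ) : ℂ) * Complex.I) ^ n)
    refine h2.deriv.trans ?_
    rw [modChar]
    ring

theorem modChar_hasTemperateGrowth (w : ℝ) : (modChar w).HasTemperateGrowth := by
  refine ⟨modChar_contDiff w, fun n => ⟨0, ‖((2 * Real.pi * w : ℝ) : ℂ) * Complex.I‖ ^ n,
    fun x => ?_⟩⟩
  rw [norm_iteratedFDeriv_eq_norm_iteratedDeriv, modChar_iteratedDeriv]
  simp [modChar_norm]

/-- The time-frequency shift `M_w T_x` on Schwartz functions: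
`(M_w T_x ψ)(y) = e^{2πiwy} ψ(y - x)`. -/
noncomputable def tfShift (x w : ℝ) (ψ : 𝓢(ℝ, ℂ)) : 𝓢(ℝ, ℂ) :=
  SchwartzMap.smulLeftCLM ℂ (modChar w) (SchwartzMap.compSubConstCLM ℂ x ψ)

theorem tfShift_apply (x w : ℝ) (ψ : 𝓢(ℝ, ℂ)) (y : ℝ) :
    tfShift x w ψ y = modChar w y * ψ (y - x) := by
  rw [tfShift, SchwartzMap.smulLeftCLM_apply_apply (modChar_hasTemperateGrowth w)]
  simp

/-- Complex conjugation of Schwartz functions. -/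
noncomputable def conjSchwartz (φ : 𝓢(ℝ, ℂ)) : 𝓢(ℝ, ℂ) :=
  SchwartzMap.postcompCLM (𝕜 := ℝ) Complex.conjCLE.toContinuousLinearMap φ

theorem conjSchwartz_apply (φ : 𝓢(ℝ, ℂ)) (y : ℝ) : conjSchwartz φ y = conj (φ y) := rfl

/-- The sesquilinear bracket `⟨f, φ⟩` of a tempered distribution and a Schwartz function.
If `f` is a function this is `∫ f(y) conj (φ(y)) dy`. -/
noncomputable def bracket (f : 𝓢'(ℝ, ℂ)) (φ : 𝓢(ℝ, ℂ)) : ℂ := f (conjSchwartz φ)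

/-- The short-time Fourier transform `V_ψ f(x, w) = ⟨f, M_w T_x ψ⟩`. -/
noncomputable def stft (ψ : 𝓢(ℝ, ℂ)) (f : 𝓢'(ℝ, ℂ)) (z : ℝ × ℝ) : ℂ :=
  bracket f (tfShift z.1 z.2 ψ)

/-- The modulation space norm `‖f‖_{M^p(ℝ)} = ‖V_ψ f‖_{L^p(ℝ²)}` (infinite when `f ∉ M^p(ℝ)`). -/
noncomputable def modNorm (ψ : 𝓢(ℝ, ℂ)) (p : ℝ≥0∞) (f : 𝓢'(ℝ, ℂ)) : ℝ≥0∞ :=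
  eLpNorm (stft ψ f) p volume

/-- Membership in the modulation space `M^p(ℝ)`. -/
def MemModulation (ψ : 𝓢(ℝ, ℂ)) (p : ℝ≥0∞) (f : 𝓢'(ℝ, ℂ)) : Prop :=
  modNorm ψ p f < ∞

/-- The filter of Schwartz functions `φ` approaching `h` in the norm of `M^p(ℝ)`. -/
noncomputable def schwartzApprox (ψ : 𝓢(ℝ, ℂ)) (p : ℝ≥0∞) (h : 𝓢'(ℝ, ℂ)) :
    Filter 𝓢(ℝ, ℂ) :=
  comap (fun φ : 𝓢(ℝ, ℂ) => modNorm ψ p (h - (φ : 𝓢'(ℝ, ℂ)))) (𝓝 0)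

/-- The pairing `⟨f, h⟩` of a tempered distribution `f` with `h ∈ M^p(ℝ)`, obtained by extending
`φ ↦ ⟨f, φ⟩` from Schwartz functions by continuity: it is the limit of `⟨f, φ⟩` as `φ → h` in
`M^p(ℝ)`. It is meaningful when `PairingExists` holds. -/
noncomputable def dualPairing (ψ : 𝓢(ℝ, ℂ)) (p : ℝ≥0∞) (f h : 𝓢'(ℝ, ℂ)) : ℂ :=
  limUnder (schwartzApprox ψ p h) (bracket f)

/-- The pairing `⟨f, h⟩` is well defined: `h` is a limit of Schwartz functions in `M^p(ℝ)`, and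
`⟨f, φ⟩` converges as `φ → h`. -/
def PairingExists (ψ : 𝓢(ℝ, ℂ)) (p : ℝ≥0∞) (f h : 𝓢'(ℝ, ℂ)) : Prop :=
  (schwartzApprox ψ p h).NeBot ∧ ∃ c : ℂ, Tendsto (bracket f) (schwartzApprox ψ p h) (𝓝 c)

theorem memLp_tfShift (x w : ℝ) (h : Lp ℂ 2 (volume : Measure ℝ)) :
    MemLp (fun y : ℝ => modChar w y * h (y - x)) 2 volume := by
  have h1 : MemLp (fun y : ℝ => h (y - x)) 2 volume :=
    (Lp.memLp h).comp_measurePreserving (measurePreserving_sub_right volume x)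
  refine h1.of_le_mul (c := 1) ?_ ?_
  · exact ((modChar_contDiff w (n := 0)).continuous.aestronglyMeasurable).mul h1.1
  · exact Eventually.of_forall fun y => by simp [modChar_norm]

/-- The time-frequency shift `M_w T_x` on `L²(ℝ)`. -/
noncomputable def tfShiftL2 (x w : ℝ) (h : Lp ℂ 2 (volume : Measure ℝ)) :
    Lp ℂ 2 (volume : Measure ℝ) :=
  (memLp_tfShift x w h).toLp (fun y : ℝ => modChar w y * h (y - x))

/-- A Schauder frame for a normed space `X`: vectors `x j` and functionals `φ j` such that
`y = ∑ j, φ j y • x j`, as a limit of partial sums in norm, for every `y`. -/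
def IsSchauderFrame {X : Type*} [NormedAddCommGroup X] [NormedSpace ℂ X]
    (x : ℕ → X) (φ : ℕ → X →L[ℂ] ℂ) : Prop :=
  ∀ y : X, Tendsto (fun N : ℕ => ∑ j ∈ Finset.range N, φ j y • x j) atTop (𝓝 y)

/-- The Gabor system element `M_{βn} T_{αk} h`, indexed by `(k, n)`. -/
noncomputable def gabor (α β : ℝ) (h : Lp ℂ 2 (volume : Measure ℝ)) (i : ℤ × ℤ) :
    Lp ℂ 2 (volume : Measure ℝ) :=
  tfShiftL2 (α * i.1) (β * i.2) h

/-- `({M_{βn}T_{αk} g}, {M_{βn}T_{αk} γ})` is a Schauder frame for `L²(ℝ)` with respect to some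
ordering of `ℤ²`. Note that `innerSL ℂ u` is the functional `f ↦ ∫ f(y) conj (u(y)) dy`. -/
def IsGaborSchauderFrame (α β : ℝ) (g γ : Lp ℂ 2 (volume : Measure ℝ)) : Prop :=
  ∃ σ : ℕ ≃ ℤ × ℤ,
    IsSchauderFrame (fun j => gabor α β g (σ j)) (fun j => innerSL ℂ (gabor α β γ (σ j)))

/-- `f = ∑ i, u i` with unconditional convergence in `M^p(ℝ)`: everything lies in `M^p(ℝ)`, and
for every ordering of the index set the partial sums converge to `f` in norm. -/
def HasUncondSum (ψ : 𝓢(ℝ, ℂ)) (p : ℝ≥0∞) (u : ℤ × ℤ → 𝓢'(ℝ, ℂ)) (f : 𝓢'(ℝ, ℂ)) : Prop :=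
  MemModulation ψ p f ∧ (∀ i, MemModulation ψ p (u i)) ∧
    ∀ σ : ℕ ≃ ℤ × ℤ,
      Tendsto (fun N : ℕ => modNorm ψ p (f - ∑ j ∈ Finset.range N, u (σ j))) atTop (𝓝 0)

/-- `(p, p₁)` is an extensible pair: `1 ≤ p ≤ 2`, `1 ≤ p₁ < ∞` and `p₁ < p / (2p - 2)`, where the
last bound is read as `∞` for `p = 1`. -/
def IsExtensiblePair (p p₁ : ℝ) : Prop :=
  1 ≤ p ∧ p ≤ 2 ∧ 1 ≤ p₁ ∧ (p = 1 ∨ p₁ < p / (2 * p - 2))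

/-! Write `V` for the short-time Fourier transform, `π(z)` for the shift by `z`, `λ_i` for the
lattice points and `E` for the window energy. The frame expansion is known only in `L²`; it is
carried over to distributions through the reproducing formula `E · Vf(u) = ∫ V(π(z)ψ)(u) Vf(z) dz`
(`windowEnergy_mul_stft`), which holds for every tempered `f`.

The kernel of this formula decays rapidly off the diagonal. Hence `Vf ∈ L^p` already forces the
suprema of `|Vf|` over lattice cells to lie in `ℓ^p` (`exists_lpSum_cellSup_stft_le`), and estimates
become discrete convolutions, governed by Young's inequality (`lpSum_conv_le`). The coefficients
`⟨f, π(λ_i)γ⟩` are dominated by `ℓ^{p₁} * ℓ^p`, so lie in `ℓ^r` with `1/r = 1/p₁ + 1/p - 1`.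
Synthesis with `g` costs one more convolution with `ℓ^p` and lands in exponent `q`, `1/q = 1/r + 1/p
- 1`. The bound on `p₁` says exactly that `1/q > 0`.

For the identity, expand the Schwartz function `π(z)ψ` in the frame and pair with `π(z₀)ψ`: the
kernel becomes a series of products `conj V(π(λ_i)γ)(z) · V(π(λ_i)g)(z₀)`. Multiply by `Vf(z)` and
integrate. The double convolution bound gives absolute convergence, so sum and integral may be
exchanged and the ordering of the frame becomes irrelevant (`hasSum_stft_gabor`). Finally the
modulation norm of a remainder is at most a constant times the `ℓ^r` norm of the omitted
coefficients, which tends to zero along every enumeration (`hasUncondSum_of_hasSum_stft`). -/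

/-! ### Discrete convolution inequalities -/

/-- The `ℓ^p` norm of a family of extended nonnegative numbers. -/
noncomputable def lpSum {ι : Type*} (p : ℝ) (a : ι → ℝ≥0∞) : ℝ≥0∞ :=
  (∑' i, a i ^ p) ^ (1 / p)

theorem lpSum_mono {ι : Type*} {p : ℝ} (hp : 0 ≤ p) {a b : ι → ℝ≥0∞} (h : ∀ i, a i ≤ b i) :
    lpSum p a ≤ lpSum p b :=
  ENNReal.rpow_le_rpow (ENNReal.tsum_le_tsum fun i => ENNReal.rpow_le_rpow (h i) hp)
    (by positivity)

theorem le_lpSum {ι : Type*} {p : ℝ} (hp : 0 < p) (a : ι → ℝ≥0∞) (i : ι) : a i ≤ lpSum p a := by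
  rw [lpSum, one_div, ENNReal.le_rpow_inv_iff hp]
  exact ENNReal.le_tsum i

theorem lpSum_comp_equiv {ι κ : Type*} (p : ℝ) (a : ι → ℝ≥0∞) (e : κ ≃ ι) :
    lpSum p (fun i => a (e i)) = lpSum p a := by
  rw [lpSum, lpSum, e.tsum_eq (fun i => a i ^ p)]

theorem lpSum_const_mul {ι : Type*} {p : ℝ} (hp : 0 < p) (c : ℝ≥0∞) (a : ι → ℝ≥0∞) :
    lpSum p (fun i => c * a i) = c * lpSum p a := by
  simp only [lpSum, ENNReal.mul_rpow_of_nonneg _ _ hp.le, ENNReal.tsum_mul_left]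
  rw [ENNReal.mul_rpow_of_nonneg _ _ (by positivity), ← ENNReal.rpow_mul, mul_one_div_cancel hp.ne',
    ENNReal.rpow_one]

/-- Hölder for counting measure; the top σ-algebra makes every function measurable. -/
theorem ENNReal.tsum_mul_rpow_three_le {ι : Type*} (f g h : ι → ℝ≥0∞) {x y z : ℝ}
    (hx : 0 ≤ x) (hy : 0 ≤ y) (hz : 0 ≤ z) (hxyz : x + y + z = 1) :
    ∑' i, f i ^ x * g i ^ y * h i ^ z
      ≤ (∑' i, f i) ^ x * (∑' i, g i) ^ y * (∑' i, h i) ^ z := by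
  let _ : MeasurableSpace ι := ⊤
  have : MeasurableSingletonClass ι := ⟨fun _ => trivial⟩
  have := ENNReal.lintegral_prod_norm_pow_le (μ := (Measure.count : Measure ι))
    (Finset.univ : Finset (Fin 3)) (f := ![f, g, h]) (fun i _ => measurable_from_top.aemeasurable)
    (p := ![x, y, z]) (by simp [Fin.sum_univ_three, hxyz])
    (fun i _ => by fin_cases i <;> simp [hx, hy, hz])
  simpa [Fin.prod_univ_three, lintegral_count] using this

/-- Young's convolution inequality on a discrete group. -/
theorem lpSum_conv_le {G : Type*} [AddCommGroup G] {s p r : ℝ} (hs : 1 ≤ s) (hp : 1 ≤ p)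
    (hr : 1 ≤ r) (h : 1 / r = 1 / s + 1 / p - 1) (a b : G → ℝ≥0∞) :
    lpSum r (fun n => ∑' m, a m * b (n - m)) ≤ lpSum s a * lpSum p b := by
  have hs0 : 0 < s := by linarith
  have hp0 : 0 < p := by linarith
  have hr0 : 0 < r := by linarith
  have hs1 : 1 / s ≤ 1 := by rw [div_le_one hs0]; exact hs
  have hp1 : 1 / p ≤ 1 := by rw [div_le_one hp0]; exact hp
  set A := ∑' m, a m ^ s with hA
  set B := ∑' m, b m ^ p with hB
  have hsplit : ∀ (t : ℝ≥0∞) {u : ℝ}, 0 < u → 0 ≤ 1 / u - 1 / r →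
      t = (t ^ u) ^ (1 / r) * (t ^ u) ^ (1 / u - 1 / r) := by
    intro t u hu h0
    rw [← ENNReal.rpow_add_of_nonneg _ _ (by positivity) h0, ← ENNReal.rpow_mul]
    have : u * (1 / r + (1 / u - 1 / r)) = 1 := by field_simp; ring
    rw [this, ENNReal.rpow_one]
  have hsub : ∀ m : G, ∑' n, b (n - m) ^ p = B := fun m =>
    (Equiv.subRight m).tsum_eq (fun n => b n ^ p)
  have hsub' : ∀ n : G, ∑' m, b (n - m) ^ p = B := fun n =>
    (Equiv.subLeft n).tsum_eq (fun n => b n ^ p)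
  -- Three-factor Hölder: the exponents `1/r`, `1/s - 1/r`, `1/p - 1/r` add up to `1` by `h`, and
  -- are nonnegative because `1/s, 1/p ≤ 1`.
  have key : ∀ n, ∑' m, a m * b (n - m) ≤
      (∑' m, a m ^ s * b (n - m) ^ p) ^ (1 / r) * A ^ (1 / s - 1 / r) * B ^ (1 / p - 1 / r) := by
    intro n
    have h3 := ENNReal.tsum_mul_rpow_three_le (fun m => a m ^ s * b (n - m) ^ p)
      (fun m => a m ^ s) (fun m => b (n - m) ^ p) (x := 1 / r) (y := 1 / s - 1 / r)
      (z := 1 / p - 1 / r) (by positivity) (by linarith) (by linarith) (by linarith)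
    rw [hsub' n] at h3
    refine le_trans (le_of_eq ?_) h3
    refine tsum_congr fun m => ?_
    conv_lhs => rw [hsplit (a m) hs0 (by linarith), hsplit (b (n - m)) hp0 (by linarith)]
    rw [ENNReal.mul_rpow_of_nonneg _ _ (by positivity : (0:ℝ) ≤ 1 / r)]
    ring
  have hsum : ∑' n, (∑' m, a m * b (n - m)) ^ r ≤
      A * B * (A ^ (1 / s - 1 / r) * B ^ (1 / p - 1 / r)) ^ r := by
    calc ∑' n, (∑' m, a m * b (n - m)) ^ r
        ≤ ∑' n, (∑' m, a m ^ s * b (n - m) ^ p) *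
            (A ^ (1 / s - 1 / r) * B ^ (1 / p - 1 / r)) ^ r := by
          refine ENNReal.tsum_le_tsum fun n => ?_
          refine (ENNReal.rpow_le_rpow (key n) hr0.le).trans (le_of_eq ?_)
          rw [mul_assoc, ENNReal.mul_rpow_of_nonneg _ _ hr0.le, ← ENNReal.rpow_mul,
            one_div_mul_cancel hr0.ne', ENNReal.rpow_one]
      _ = A * B * (A ^ (1 / s - 1 / r) * B ^ (1 / p - 1 / r)) ^ r := by
          -- The remaining convolution of `a ^ s` with `b ^ p` has total mass `A * B`.
          rw [ENNReal.tsum_mul_right, ENNReal.tsum_comm]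
          simp only [ENNReal.tsum_mul_left, hsub, ENNReal.tsum_mul_right, ← hA]
  refine (ENNReal.rpow_le_rpow hsum (by positivity)).trans (le_of_eq ?_)
  rw [ENNReal.mul_rpow_of_nonneg _ _ (by positivity), ← ENNReal.rpow_mul,
    mul_one_div_cancel hr0.ne', ENNReal.rpow_one, ENNReal.mul_rpow_of_nonneg _ _ (by positivity)]
  rw [show A ^ (1 / r) * B ^ (1 / r) * (A ^ (1 / s - 1 / r) * B ^ (1 / p - 1 / r))
      = (A ^ (1 / r) * A ^ (1 / s - 1 / r)) * (B ^ (1 / r) * B ^ (1 / p - 1 / r)) by ring,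
    ← ENNReal.rpow_add_of_nonneg _ _ (by positivity) (by linarith),
    ← ENNReal.rpow_add_of_nonneg _ _ (by positivity) (by linarith)]
  simp [lpSum, hA, hB]

/-! ### Decomposition of the plane into lattice cells -/

/-- The cell `[αk, α(k+1)) × [βn, β(n+1))` of the lattice `αℤ × βℤ`. -/
def cell (α β : ℝ) (i : ℤ × ℤ) : Set (ℝ × ℝ) :=
  {z | ⌊z.1 / α⌋ = i.1 ∧ ⌊z.2 / β⌋ = i.2}

theorem mem_cell_self (α β : ℝ) (z : ℝ × ℝ) : z ∈ cell α β (⌊z.1 / α⌋, ⌊z.2 / β⌋) :=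
  ⟨rfl, rfl⟩

theorem cell_eq_prod {α β : ℝ} (hα : 0 < α) (hβ : 0 < β) (i : ℤ × ℤ) :
    cell α β i = Set.Ico (α * i.1) (α * (i.1 + 1)) ×ˢ Set.Ico (β * i.2) (β * (i.2 + 1)) := by
  ext z
  simp only [cell, Set.mem_ofPred_eq, Int.floor_eq_iff, Set.mem_prod, Set.mem_Ico, le_div_iff₀ hα,
    le_div_iff₀ hβ, div_lt_iff₀ hα, div_lt_iff₀ hβ, mul_comm]

theorem measurableSet_cell {α β : ℝ} (hα : 0 < α) (hβ : 0 < β) (i : ℤ × ℤ) :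
    MeasurableSet (cell α β i) := by
  rw [cell_eq_prod hα hβ]
  exact measurableSet_Ico.prod measurableSet_Ico

theorem volume_cell {α β : ℝ} (hα : 0 < α) (hβ : 0 < β) (i : ℤ × ℤ) :
    volume (cell α β i) = ENNReal.ofReal α * ENNReal.ofReal β := by
  rw [cell_eq_prod hα hβ, Measure.volume_eq_prod, Measure.prod_prod, Real.volume_Ico,
    Real.volume_Ico]
  congr 2 <;> ring

theorem lintegral_eq_tsum_cell {α β : ℝ} (hα : 0 < α) (hβ : 0 < β) (F : ℝ × ℝ → ℝ≥0∞) :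
    ∫⁻ z, F z = ∑' i, ∫⁻ z in cell α β i, F z := by
  have huniv : (⋃ i, cell α β i) = Set.univ :=
    Set.eq_univ_of_forall fun z => Set.mem_iUnion.2 ⟨_, mem_cell_self α β z⟩
  rw [← lintegral_iUnion (fun i => measurableSet_cell hα hβ i), huniv, setLIntegral_univ]
  intro i j hij
  refine Set.disjoint_left.2 fun z hi hj => hij ?_
  exact Prod.ext (hi.1.symm.trans hj.1) (hi.2.symm.trans hj.2)

/-- The supremum of `F` over a lattice cell. -/
noncomputable def cellSup (α β : ℝ) (F : ℝ × ℝ → ℝ≥0∞) (i : ℤ × ℤ) : ℝ≥0∞ :=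
  ⨆ z ∈ cell α β i, F z

theorem le_cellSup {α β : ℝ} (F : ℝ × ℝ → ℝ≥0∞) {i : ℤ × ℤ} {z : ℝ × ℝ} (hz : z ∈ cell α β i) :
    F z ≤ cellSup α β F i :=
  le_iSup₂ (f := fun z (_ : z ∈ cell α β i) => F z) z hz

theorem lintegral_le_tsum_of_le {α β : ℝ} (hα : 0 < α) (hβ : 0 < β) {F : ℝ × ℝ → ℝ≥0∞}
    {a : ℤ × ℤ → ℝ≥0∞} (h : ∀ i, ∀ z ∈ cell α β i, F z ≤ a i) :
    ∫⁻ z, F z ≤ ENNReal.ofReal α * ENNReal.ofReal β * ∑' i, a i := by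
  rw [lintegral_eq_tsum_cell hα hβ, ← ENNReal.tsum_mul_left]
  refine ENNReal.tsum_le_tsum fun i => ?_
  calc ∫⁻ z in cell α β i, F z ≤ ∫⁻ _ in cell α β i, a i :=
        setLIntegral_mono' (measurableSet_cell hα hβ i) (h i)
    _ = _ := by rw [setLIntegral_const, volume_cell hα hβ, mul_comm]

/-- The easy direction between functions and sequences, valid for every `F`; the reverse one needs
the smoothing of `exists_lpSum_cellSup_le`. -/
theorem lintegral_rpow_le_lpSum_cellSup {α β : ℝ} (hα : 0 < α) (hβ : 0 < β) {p : ℝ} (hp : 0 < p)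
    {F : ℝ × ℝ → ℝ≥0∞} {a : ℤ × ℤ → ℝ≥0∞} (h : ∀ i, ∀ z ∈ cell α β i, F z ≤ a i) :
    (∫⁻ z, F z ^ p) ^ (1 / p)
      ≤ (ENNReal.ofReal α * ENNReal.ofReal β) ^ (1 / p) * lpSum p a := by
  rw [lpSum, ← ENNReal.mul_rpow_of_nonneg _ _ (by positivity)]
  refine ENNReal.rpow_le_rpow ?_ (by positivity)
  exact lintegral_le_tsum_of_le hα hβ fun i z hz => ENNReal.rpow_le_rpow (h i z hz) hp.le

/-- The point of the lattice `αℤ × βℤ` with index `i`. -/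
def latticePoint (α β : ℝ) (i : ℤ × ℤ) : ℝ × ℝ := (α * i.1, β * i.2)

/-- Lattice translations permute the cells. This is what turns sums over translates into discrete
convolutions. -/
theorem sub_latticePoint_mem_cell {α β : ℝ} (hα : 0 < α) (hβ : 0 < β) {i j : ℤ × ℤ} {z : ℝ × ℝ}
    (hz : z ∈ cell α β i) : z - latticePoint α β j ∈ cell α β (i - j) := by
  constructor
  · simp only [latticePoint, Prod.fst_sub, sub_div, mul_div_cancel_left₀ _ hα.ne',
      Int.floor_sub_intCast, hz.1]
  · simp only [latticePoint, Prod.snd_sub, sub_div, mul_div_cancel_left₀ _ hβ.ne',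
      Int.floor_sub_intCast, hz.2]

/-- A polynomially decaying weight on the plane. -/
noncomputable def decayWeight (z : ℝ × ℝ) : ℝ := ((1 + |z.1|) ^ 2 * (1 + |z.2|) ^ 2)⁻¹

theorem decayWeight_nonneg (z : ℝ × ℝ) : 0 ≤ decayWeight z := by
  unfold decayWeight; positivity

theorem tsum_decayWeight_latticePoint_lt_top {α β : ℝ} (hα : 0 < α) (hβ : 0 < β) :
    ∑' i, ENNReal.ofReal (decayWeight (latticePoint α β i)) < ∞ := by
  have h1 : ∀ {δ : ℝ}, 0 < δ → Summable fun k : ℤ => ((1 + |δ * k|) ^ 2)⁻¹ := by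
    intro δ hδ
    have hs : Summable fun k : ℤ => (δ ^ 2)⁻¹ * (1 / (k : ℝ) ^ 2) :=
      (Real.summable_one_div_int_pow.2 (by norm_num)).mul_left _
    -- The comparison fails at `k = 0`, where the majorant takes the value `1 / 0 = 0`.
    refine Summable.of_norm_bounded_eventually hs ?_
    filter_upwards [(Set.finite_singleton (0 : ℤ)).compl_mem_cofinite] with k hk
    have hk0 : (k : ℝ) ≠ 0 := by exact_mod_cast hk
    rw [Real.norm_of_nonneg (by positivity), one_div, ← mul_inv, ← mul_pow]
    refine inv_anti₀ (by positivity) ?_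
    rw [← sq_abs (δ * k)]
    gcongr
    linarith
  have h2 := (h1 hα).mul_of_nonneg (h1 hβ) (fun _ => by positivity) (fun _ => by positivity)
  refine (ENNReal.ofReal_tsum_of_nonneg (fun i => decayWeight_nonneg _) ?_).symm.trans_lt
    ENNReal.ofReal_lt_top
  simpa only [decayWeight, latticePoint, mul_inv] using h2

/-- Replacing both points by the corners of their cells changes a coordinate difference by at most
the side `δ`, which a factor `1 + δ` absorbs. -/
theorem decayWeight_sub_le {α β : ℝ} (hα : 0 < α) (hβ : 0 < β) {i j : ℤ × ℤ} {u z : ℝ × ℝ}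
    (hu : u ∈ cell α β i) (hz : z ∈ cell α β j) :
    decayWeight (u - z)
      ≤ ((1 + α) * (1 + β)) ^ 2 * decayWeight (latticePoint α β (i - j)) := by
  have aux : ∀ {δ a b k l : ℝ}, 0 < δ → a ∈ Set.Ico (δ * k) (δ * (k + 1)) →
      b ∈ Set.Ico (δ * l) (δ * (l + 1)) → 1 + |δ * (k - l)| ≤ (1 + δ) * (1 + |a - b|) := by
    intro δ a b k l hδ ha hb
    have h1 : |δ * (k - l)| ≤ |a - b| + δ := by
      have : δ * (k - l) = (a - b) + ((b - δ * l) - (a - δ * k)) := by ring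
      rw [this]
      refine (abs_add_le _ _).trans (add_le_add le_rfl ?_)
      rw [abs_le]
      constructor <;> linarith [ha.1, ha.2, hb.1, hb.2]
    nlinarith [abs_nonneg (a - b)]
  rw [cell_eq_prod hα hβ] at hu hz
  have e1 := aux hα hu.1 hz.1
  have e2 := aux hβ hu.2 hz.2
  unfold decayWeight latticePoint
  simp only [Prod.fst_sub, Prod.snd_sub, Int.cast_sub]
  rw [← div_eq_mul_inv, le_div_iff₀ (by positivity), inv_mul_le_iff₀ (by positivity)]
  calc _ ≤ ((1 + α) * (1 + |u.1 - z.1|)) ^ 2 * ((1 + β) * (1 + |u.2 - z.2|)) ^ 2 := by gcongr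
    _ = _ := by ring

theorem setLIntegral_cell_le {α β : ℝ} (hα : 0 < α) (hβ : 0 < β) {p : ℝ} (hp : 1 ≤ p)
    {F : ℝ × ℝ → ℝ≥0∞} (hF : AEMeasurable F) (i : ℤ × ℤ) :
    ∫⁻ z in cell α β i, F z
      ≤ (ENNReal.ofReal α * ENNReal.ofReal β) ^ (1 - 1 / p) *
        (∫⁻ z in cell α β i, F z ^ p) ^ (1 / p) := by
  have hp0 : 0 < p := by linarith
  have h1 : 1 / p ≤ 1 := by rw [div_le_one hp0]; exact hp
  have := ENNReal.lintegral_mul_norm_pow_le (μ := volume.restrict (cell α β i))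
    (f := fun z => F z ^ p) (g := fun _ => 1) (hF.restrict.pow_const p) aemeasurable_const
    (p := 1 / p) (q := 1 - 1 / p) (by positivity) (by linarith) (by ring)
  simp only [← ENNReal.rpow_mul, mul_one_div_cancel hp0.ne', ENNReal.rpow_one, ENNReal.one_rpow,
    mul_one, lintegral_const, one_mul, Measure.restrict_apply MeasurableSet.univ, Set.univ_inter,
    volume_cell hα hβ] at this
  rwa [mul_comm] at this

/-- A function dominated by the convolution of `F ∈ L^p` with a rapidly decaying kernel has
`p`-summable local suprema. -/
theorem exists_lpSum_cellSup_le {α β : ℝ} (hα : 0 < α) (hβ : 0 < β) {p : ℝ} (hp : 1 ≤ p) :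
    ∃ C : ℝ≥0∞, C ≠ ∞ ∧ ∀ (F G : ℝ × ℝ → ℝ≥0∞) (c : ℝ≥0∞), AEMeasurable F →
      (∀ u, G u ≤ c * ∫⁻ z, F z * ENNReal.ofReal (decayWeight (u - z))) →
      lpSum p (cellSup α β G) ≤ C * c * (∫⁻ z, F z ^ p) ^ (1 / p) := by
  have hp0 : 0 < p := by linarith
  have h1 : 1 / p ≤ 1 := by rw [div_le_one hp0]; exact hp
  set θ : ℤ × ℤ → ℝ≥0∞ := fun i => ENNReal.ofReal (decayWeight (latticePoint α β i)) with hθ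
  set K : ℝ≥0∞ := ENNReal.ofReal (((1 + α) * (1 + β)) ^ 2) with hK
  set v : ℝ≥0∞ := (ENNReal.ofReal α * ENNReal.ofReal β) ^ (1 - 1 / p) with hv
  have hvtop : v ≠ ∞ := ENNReal.rpow_ne_top_of_nonneg (by linarith) (by finiteness)
  refine ⟨K * (v * ∑' i, θ i), ?_, fun F G c hF hG => ?_⟩
  · have := (tsum_decayWeight_latticePoint_lt_top hα hβ).ne
    finiteness
  set b : ℤ × ℤ → ℝ≥0∞ := fun j => (∫⁻ z in cell α β j, F z ^ p) ^ (1 / p) with hb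
  -- For `u` in cell `i` and `z` in cell `j` the weight is at most `K * θ (i - j)`. Hölder on each
  -- cell then leaves the convolution of the local `L^p` norms `b` with the summable `θ`.
  have hsup : ∀ i, cellSup α β G i ≤ (c * K * v) * ∑' j, b j * θ (i - j) := by
    intro i
    refine iSup₂_le fun u hu => (hG u).trans ?_
    rw [mul_assoc, mul_assoc]
    gcongr
    rw [lintegral_eq_tsum_cell hα hβ, ← ENNReal.tsum_mul_left, ← ENNReal.tsum_mul_left]
    refine ENNReal.tsum_le_tsum fun j => ?_
    calc ∫⁻ z in cell α β j, F z * ENNReal.ofReal (decayWeight (u - z))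
        ≤ ∫⁻ z in cell α β j, F z * (K * θ (i - j)) := by
          refine setLIntegral_mono' (measurableSet_cell hα hβ j) fun z hz => ?_
          gcongr
          rw [hK, hθ, ← ENNReal.ofReal_mul (by positivity)]
          exact ENNReal.ofReal_le_ofReal (decayWeight_sub_le hα hβ hu hz)
      _ = (∫⁻ z in cell α β j, F z) * (K * θ (i - j)) :=
          lintegral_mul_const'' _ hF.restrict
      _ ≤ (v * b j) * (K * θ (i - j)) := by
          gcongr
          exact setLIntegral_cell_le hα hβ hp hF j
      _ = K * (v * (b j * θ (i - j))) := by ring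
  have hbsum : lpSum p b = (∫⁻ z, F z ^ p) ^ (1 / p) := by
    rw [lpSum, lintegral_eq_tsum_cell hα hβ]
    congr 1
    refine tsum_congr fun j => ?_
    rw [hb, ← ENNReal.rpow_mul, one_div_mul_cancel hp0.ne', ENNReal.rpow_one]
  have hθsum : lpSum 1 θ = ∑' i, θ i := by simp [lpSum]
  calc lpSum p (cellSup α β G)
      ≤ lpSum p (fun i => (c * K * v) * ∑' j, b j * θ (i - j)) := lpSum_mono hp0.le hsup
    _ = (c * K * v) * lpSum p (fun i => ∑' j, b j * θ (i - j)) := lpSum_const_mul hp0 _ _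
    _ ≤ (c * K * v) * (lpSum p b * lpSum 1 θ) := by
        gcongr
        exact lpSum_conv_le hp le_rfl hp (by ring) b θ
    _ = _ := by rw [hbsum, hθsum]; ring

open scoped BoundedContinuousFunction

/-! ### Weak integrals of Schwartz functions -/

/-- Multiplication of Schwartz functions by the variable. -/
noncomputable def positionCLM : 𝓢(ℝ, ℂ) →L[ℂ] 𝓢(ℝ, ℂ) :=
  SchwartzMap.smulLeftCLM ℂ (fun y : ℝ => (y : ℂ))

theorem positionCLM_apply (φ : 𝓢(ℝ, ℂ)) (y : ℝ) : positionCLM φ y = y * φ y := by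
  rw [positionCLM, SchwartzMap.smulLeftCLM_apply_apply (by fun_prop), smul_eq_mul]

/-- The bounded continuous function `y ↦ y^k φ^{(l)}(y)` attached to a Schwartz function `φ`. -/
noncomputable def monomialCLM (k l : ℕ) : 𝓢(ℝ, ℂ) →L[ℂ] (ℝ →ᵇ ℂ) :=
  SchwartzMap.toBoundedContinuousFunctionCLM ℂ ℝ ℂ ∘L
    (positionCLM ^ k * SchwartzMap.derivCLM ℂ ℂ ^ l)

theorem monomialCLM_succ_right (k l : ℕ) (φ : 𝓢(ℝ, ℂ)) :
    monomialCLM k (l + 1) φ = monomialCLM k l (SchwartzMap.derivCLM ℂ ℂ φ) := by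
  simp only [monomialCLM, pow_succ, ← mul_assoc]
  rfl

theorem monomialCLM_succ_left (k : ℕ) (φ : 𝓢(ℝ, ℂ)) :
    monomialCLM (k + 1) 0 φ = monomialCLM k 0 (positionCLM φ) := by
  simp only [monomialCLM, pow_succ, pow_zero, mul_one]
  rfl

theorem positionCLM_pow_apply (k : ℕ) (φ : 𝓢(ℝ, ℂ)) (y : ℝ) :
    (positionCLM ^ k) φ y = (y : ℂ) ^ k * φ y := by
  induction k generalizing φ with
  | zero => simp
  | succ k ih =>
    rw [pow_succ, mul_apply_eq_comp, ih, positionCLM_apply, pow_succ, mul_assoc]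

theorem derivCLM_pow_apply (l : ℕ) (φ : 𝓢(ℝ, ℂ)) (y : ℝ) :
    (SchwartzMap.derivCLM ℂ ℂ ^ l) φ y = iteratedDeriv l φ y := by
  induction l generalizing φ with
  | zero => simp
  | succ l ih =>
    rw [pow_succ, mul_apply_eq_comp, ih, iteratedDeriv_succ']
    rfl

theorem monomialCLM_apply (k l : ℕ) (φ : 𝓢(ℝ, ℂ)) (y : ℝ) :
    monomialCLM k l φ y = (y : ℂ) ^ k * iteratedDeriv l φ y := by
  rw [monomialCLM, ContinuousLinearMap.comp_apply, mul_apply_eq_comp,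
    SchwartzMap.toBoundedContinuousFunctionCLM_apply, positionCLM_pow_apply, derivCLM_pow_apply]

theorem seminorm_le_norm_monomialCLM (k l : ℕ) (φ : 𝓢(ℝ, ℂ)) :
    SchwartzMap.seminorm ℂ k l φ ≤ ‖monomialCLM k l φ‖ := by
  refine SchwartzMap.seminorm_le_bound' ℂ k l φ (norm_nonneg _) fun y => ?_
  have := (monomialCLM k l φ).norm_coe_le_norm y
  rw [monomialCLM_apply, norm_mul, norm_pow, Complex.norm_real, Real.norm_eq_abs] at this
  exact this

/-- A tempered distribution extends to a continuous functional on a finite product of spaces of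
bounded continuous functions. -/
theorem exists_factor_monomialCLM (f : 𝓢'(ℝ, ℂ)) :
    ∃ (s : Finset (ℕ × ℕ)) (L : (s → (ℝ →ᵇ ℂ)) →L[ℂ] ℂ),
      ∀ φ, f φ = L (fun i => monomialCLM i.1.1 i.1.2 φ) := by
  obtain ⟨s, C, -, hC⟩ := Seminorm.bound_of_continuous (schwartz_withSeminorms ℂ ℝ ℂ)
    ((normSeminorm ℂ ℂ).comp (f : 𝓢(ℝ, ℂ) →ₗ[ℂ] ℂ)) (continuous_norm.comp (map_continuous f))
  let J : 𝓢(ℝ, ℂ) →ₗ[ℂ] (s → (ℝ →ᵇ ℂ)) :=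
    LinearMap.pi fun i => (monomialCLM i.1.1 i.1.2 : 𝓢(ℝ, ℂ) →ₗ[ℂ] (ℝ →ᵇ ℂ))
  have hJ : ∀ φ, ‖f φ‖ ≤ C * ‖J φ‖ := by
    intro φ
    refine (hC φ).trans ?_
    change C * (s.sup (schwartzSeminormFamily ℂ ℝ ℂ)) φ ≤ _
    gcongr
    refine Seminorm.finset_sup_apply_le (norm_nonneg _) fun i hi => ?_
    exact (seminorm_le_norm_monomialCLM i.1 i.2 φ).trans (norm_le_pi_norm (J φ) ⟨i, hi⟩)
  -- The seminorm bound makes `f` descend to the range of `J`, where it is bounded; Hahn–Banach then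
  -- extends it. The target of `J` is a Banach space, so Bochner integrals become available.
  have hker : LinearMap.ker J ≤ LinearMap.ker (f : 𝓢(ℝ, ℂ) →ₗ[ℂ] ℂ) := by
    intro φ hφ
    have := hJ φ
    rw [LinearMap.mem_ker.1 hφ, norm_zero, mul_zero] at this
    exact norm_le_zero_iff.1 this
  let g : Module.Dual ℂ (LinearMap.range J) :=
    ((LinearMap.ker J).liftQ (f : 𝓢(ℝ, ℂ) →ₗ[ℂ] ℂ) hker) ∘ₗ
      (J.quotKerEquivRange.symm : LinearMap.range J →ₗ[ℂ] _)
  have hg : ∀ φ, g ⟨J φ, LinearMap.mem_range_self J φ⟩ = f φ := by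
    intro φ
    have : J.quotKerEquivRange.symm ⟨J φ, LinearMap.mem_range_self J φ⟩
        = (LinearMap.ker J).mkQ φ := by
      rw [LinearEquiv.symm_apply_eq]
      rfl
    change ((LinearMap.ker J).liftQ (f : 𝓢(ℝ, ℂ) →ₗ[ℂ] ℂ) hker) (J.quotKerEquivRange.symm _) = _
    rw [this]
    rfl
  obtain ⟨L, hL, -⟩ := Module.Dual.exists_continuous_extension_of_le_seminorm (LinearMap.range J) g
    (p := C • normSeminorm ℂ (s → (ℝ →ᵇ ℂ))) (continuous_norm.const_smul C) (by
      rintro ⟨_, φ, rfl⟩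
      rw [hg]
      exact hJ φ)
  exact ⟨s, L, fun φ => ((hL ⟨J φ, LinearMap.mem_range_self J φ⟩).trans (hg φ)).symm⟩

/-- A family of Schwartz functions which is integrable for all Schwartz seminorms has a weak
integral in the Schwartz space. -/
theorem exists_schwartz_integral {Z : Type*} [MeasurableSpace Z] {μ : Measure Z}
    (K : Z → 𝓢(ℝ, ℂ)) (hK : ∀ k l, Integrable (fun z => monomialCLM k l (K z)) μ) :
    ∃ Φ : 𝓢(ℝ, ℂ), (∀ y, Φ y = ∫ z, K z y ∂μ) ∧ ∀ f : 𝓢'(ℝ, ℂ), f Φ = ∫ z, f (K z) ∂μ := by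
  -- `I k l` is the future `y ^ k * Φ^(l)`. Being a bounded function, it supplies the Schwartz decay
  -- of `Φ = I 0 0` once differentiation under the integral is justified.
  let I : ℕ → ℕ → (ℝ →ᵇ ℂ) := fun k l => ∫ z, monomialCLM k l (K z) ∂μ
  have hI : ∀ k l y, I k l y = ∫ z, monomialCLM k l (K z) y ∂μ := fun k l y =>
    ((BoundedContinuousFunction.evalCLM ℂ y).integral_comp_comm (hK k l)).symm
  have hintegrable : ∀ k l y, Integrable (fun z => monomialCLM k l (K z) y) μ := fun k l y =>
    (BoundedContinuousFunction.evalCLM ℂ y).integrable_comp (hK k l)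
  have hder : ∀ l y, HasDerivAt (I 0 l) (I 0 (l + 1) y) y := by
    intro l y
    have := (hasDerivAt_integral_of_dominated_loc_of_deriv_le (𝕜 := ℝ) (μ := μ) (x₀ := y)
      (F := fun y z => monomialCLM 0 l (K z) y) (F' := fun y z => monomialCLM 0 (l + 1) (K z) y)
      (bound := fun z => ‖monomialCLM 0 (l + 1) (K z)‖) univ_mem
      (Eventually.of_forall fun y => (hintegrable 0 l y).aestronglyMeasurable) (hintegrable 0 l y)
      (hintegrable 0 (l + 1) y).aestronglyMeasurable
      (Eventually.of_forall fun z y _ => BoundedContinuousFunction.norm_coe_le_norm _ y)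
      (hK 0 (l + 1)).norm
      (Eventually.of_forall fun z y _ => by
        simp only [monomialCLM_apply, pow_zero, one_mul]
        rw [iteratedDeriv_succ]
        exact (((K z).smooth ⊤).differentiable_iteratedDeriv l
          (by exact_mod_cast ENat.natCast_lt_top l) y).hasDerivAt)).2
    simpa only [← hI] using this
  have hiter : ∀ l, iteratedDeriv l (I 0 0) = I 0 l := by
    intro l
    induction l with
    | zero => simp
    | succ l ih =>
      rw [iteratedDeriv_succ, ih]
      exact funext fun y => (hder l y).deriv
  have hpow : ∀ k l y, I k l y = (y : ℂ) ^ k * I 0 l y := by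
    intro k l y
    rw [hI, hI, ← integral_const_mul]
    simp [monomialCLM_apply]
  let Φ : 𝓢(ℝ, ℂ) :=
    { toFun := I 0 0
      smooth' := contDiff_of_differentiable_iteratedDeriv fun l _ => by
        rw [hiter]
        exact fun y => (hder l y).differentiableAt
      decay' := fun k l => ⟨‖I k l‖, fun y => by
        rw [norm_iteratedFDeriv_eq_norm_iteratedDeriv, hiter]
        refine le_trans (le_of_eq ?_) ((I k l).norm_coe_le_norm y)
        rw [hpow k, norm_mul, norm_pow, Complex.norm_real]⟩ }
  have hΦ : ∀ k l, monomialCLM k l Φ = I k l := by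
    intro k l
    ext y
    rw [monomialCLM_apply, hpow, ← hiter]
    rfl
  refine ⟨Φ, fun y => ?_, fun f => ?_⟩
  · change I 0 0 y = _
    rw [hI]
    simp [monomialCLM_apply]
  · obtain ⟨s, L, hL⟩ := exists_factor_monomialCLM f
    have hintegrable_pi : Integrable (fun z => fun i : s => monomialCLM i.1.1 i.1.2 (K z)) μ :=
      Integrable.of_eval fun i => hK _ _
    simp only [hL]
    rw [L.integral_comp_comm hintegrable_pi]
    congr 1
    funext i
    rw [hΦ]
    exact ((ContinuousLinearMap.proj (R := ℂ) (φ := fun _ : s => (ℝ →ᵇ ℂ)) i).integral_comp_comm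
      hintegrable_pi)

/-! ### Time-frequency shifts in the Schwartz space -/

theorem modChar_add (v w y : ℝ) : modChar (v + w) y = modChar v y * modChar w y := by
  rw [modChar, modChar, modChar, ← Complex.exp_add]
  congr 1
  push_cast
  ring

theorem modChar_add_right (w x y : ℝ) : modChar w (x + y) = modChar w x * modChar w y := by
  rw [modChar, modChar, modChar, ← Complex.exp_add]
  congr 1
  push_cast
  ring

theorem conj_modChar (w y : ℝ) : conj (modChar w y) = modChar (-w) y := by
  rw [modChar, modChar, ← Complex.exp_conj]
  congr 1
  simp only [map_mul, Complex.conj_ofReal, Complex.conj_I]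
  push_cast
  ring

theorem hasDerivAt_modChar (w y : ℝ) :
    HasDerivAt (modChar w) (((2 * Real.pi * w : ℝ) : ℂ) * Complex.I * modChar w y) y := by
  have h := (modChar_contDiff w (n := 1)).differentiable one_ne_zero y
  have e : deriv (modChar w) y = ((2 * Real.pi * w : ℝ) : ℂ) * Complex.I * modChar w y := by
    have := congrFun (modChar_iteratedDeriv w 1) y
    simpa using this
  exact e ▸ h.hasDerivAt

theorem conjSchwartz_tfShift (x w : ℝ) (ψ : 𝓢(ℝ, ℂ)) :
    conjSchwartz (tfShift x w ψ) = tfShift x (-w) (conjSchwartz ψ) := by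
  ext y
  simp [conjSchwartz_apply, tfShift_apply, conj_modChar]

theorem conjSchwartz_conjSchwartz (φ : 𝓢(ℝ, ℂ)) : conjSchwartz (conjSchwartz φ) = φ := by
  ext y
  simp [conjSchwartz_apply]

theorem derivCLM_tfShift (x w : ℝ) (ψ : 𝓢(ℝ, ℂ)) :
    SchwartzMap.derivCLM ℂ ℂ (tfShift x w ψ)
      = (((2 * Real.pi * w : ℝ) : ℂ) * Complex.I) • tfShift x w ψ
        + tfShift x w (SchwartzMap.derivCLM ℂ ℂ ψ) := by
  ext y
  have h1 : HasDerivAt (fun y => ψ (y - x)) (deriv ψ (y - x)) y :=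
    (ψ.hasDerivAt (y - x)).comp_sub_const y x
  have h2 := (hasDerivAt_modChar w y).mul h1
  have h3 : (tfShift x w ψ : ℝ → ℂ) = modChar w * fun y => ψ (y - x) :=
    funext fun y => tfShift_apply x w ψ y
  rw [SchwartzMap.derivCLM_apply, h3, h2.deriv]
  simp [tfShift_apply, SchwartzMap.derivCLM_apply, mul_assoc]

theorem positionCLM_tfShift (x w : ℝ) (ψ : 𝓢(ℝ, ℂ)) :
    positionCLM (tfShift x w ψ) = (x : ℂ) • tfShift x w ψ + tfShift x w (positionCLM ψ) := by
  ext y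
  simp only [positionCLM_apply, tfShift_apply, add_apply, smul_apply,
    smul_eq_mul]
  push_cast
  ring

theorem norm_monomialCLM_tfShift_zero_le (ψ : 𝓢(ℝ, ℂ)) (x w : ℝ) :
    ‖monomialCLM 0 0 (tfShift x w ψ)‖ ≤ ‖monomialCLM 0 0 ψ‖ := by
  refine (BoundedContinuousFunction.norm_le (norm_nonneg _)).2 fun y => ?_
  have := (monomialCLM 0 0 ψ).norm_coe_le_norm (y - x)
  simpa [monomialCLM_apply, tfShift_apply, modChar_norm] using this

/-- Commuting one multiplication by `y` or one derivative past the shift costs a factor `x` or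
`2πiw` (`positionCLM_tfShift`, `derivCLM_tfShift`). -/
theorem exists_norm_monomialCLM_tfShift_le (k l : ℕ) (ψ : 𝓢(ℝ, ℂ)) :
    ∃ C : ℝ, 0 ≤ C ∧ ∀ x w : ℝ,
      ‖monomialCLM k l (tfShift x w ψ)‖ ≤ C * ((1 + |x|) ^ k * (1 + |w|) ^ l) := by
  induction l generalizing ψ with
  | zero =>
    induction k generalizing ψ with
    | zero =>
      exact ⟨_, norm_nonneg _, fun x w => by simpa using norm_monomialCLM_tfShift_zero_le ψ x w⟩
    | succ k ih =>
      obtain ⟨C₁, h₁, hC₁⟩ := ih ψ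
      obtain ⟨C₂, h₂, hC₂⟩ := ih (positionCLM ψ)
      refine ⟨C₁ + C₂, by positivity, fun x w => ?_⟩
      rw [monomialCLM_succ_left, positionCLM_tfShift, map_add, map_smul]
      refine (norm_add_le _ _).trans ?_
      rw [norm_smul, Complex.norm_real, Real.norm_eq_abs]
      have e₁ := hC₁ x w
      have e₂ := hC₂ x w
      rw [pow_zero, mul_one] at e₁ e₂ ⊢
      calc _ ≤ |x| * (C₁ * (1 + |x|) ^ k) + C₂ * (1 + |x|) ^ k := by gcongr
        _ ≤ (1 + |x|) * (C₁ * (1 + |x|) ^ k) + (1 + |x|) * (C₂ * (1 + |x|) ^ k) := by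
            refine add_le_add (by gcongr; linarith) ?_
            exact le_mul_of_one_le_left (by positivity) (by linarith [abs_nonneg x])
        _ = _ := by ring
  | succ l ih =>
    obtain ⟨C₁, h₁, hC₁⟩ := ih ψ
    obtain ⟨C₂, h₂, hC₂⟩ := ih (SchwartzMap.derivCLM ℂ ℂ ψ)
    refine ⟨2 * Real.pi * C₁ + C₂, by positivity, fun x w => ?_⟩
    rw [monomialCLM_succ_right, derivCLM_tfShift, map_add, map_smul]
    refine (norm_add_le _ _).trans ?_
    rw [norm_smul, norm_mul, Complex.norm_real, Complex.norm_I, mul_one, Real.norm_eq_abs, abs_mul,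
      abs_of_pos Real.two_pi_pos]
    have e₁ := hC₁ x w
    have e₂ := hC₂ x w
    set P := (1 + |x|) ^ k * (1 + |w|) ^ l with hP
    have hP0 : 0 ≤ P := by positivity
    calc _ ≤ 2 * Real.pi * |w| * (C₁ * P) + C₂ * P := by gcongr
      _ ≤ 2 * Real.pi * (1 + |w|) * (C₁ * P) + (1 + |w|) * (C₂ * P) := by
          refine add_le_add (by gcongr; linarith) ?_
          exact le_mul_of_one_le_left (by positivity) (by linarith [abs_nonneg w])
      _ = _ := by rw [hP]; ring

theorem norm_modChar_sub_le (v w y : ℝ) :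
    ‖modChar v y - modChar w y‖ ≤ 2 * Real.pi * |v - w| * |y| := by
  have h1 : modChar v y - modChar w y = modChar w y * (modChar (v - w) y - 1) := by
    rw [mul_sub, ← modChar_add, mul_one, add_sub_cancel]
  have h2 : modChar (v - w) y
      = Complex.exp (Complex.I * ((2 * Real.pi * (v - w) * y : ℝ) : ℂ)) := by
    rw [modChar]
    congr 1
    push_cast
    ring
  rw [h1, norm_mul, modChar_norm, one_mul, h2]
  refine (Real.norm_exp_I_mul_ofReal_sub_one_le).trans (le_of_eq ?_)
  rw [Real.norm_eq_abs, abs_mul, abs_mul, abs_of_pos Real.two_pi_pos]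

/-- The same commutation relations reduce the claim to the sup norm, where translation is Lipschitz
by the mean value inequality and modulation by `norm_modChar_sub_le`. -/
theorem continuous_monomialCLM_tfShift (k l : ℕ) (ψ : 𝓢(ℝ, ℂ)) :
    Continuous fun z : ℝ × ℝ => monomialCLM k l (tfShift z.1 z.2 ψ) := by
  induction l generalizing ψ with
  | zero =>
    induction k generalizing ψ with
    | zero =>
      rw [continuous_iff_continuousAt]
      intro z₀
      rw [ContinuousAt, tendsto_iff_norm_sub_tendsto_zero]
      set A := ‖monomialCLM 0 0 (SchwartzMap.derivCLM ℂ ℂ ψ)‖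
      set B := ‖monomialCLM 0 0 (positionCLM ψ)‖
      set D := ‖monomialCLM 0 0 ψ‖
      have hbound : ∀ z : ℝ × ℝ,
          ‖monomialCLM 0 0 (tfShift z.1 z.2 ψ) - monomialCLM 0 0 (tfShift z₀.1 z₀.2 ψ)‖
            ≤ 2 * Real.pi * |z.2 - z₀.2| * (B + |z.1| * D) + A * |z.1 - z₀.1| := by
        intro z
        refine (BoundedContinuousFunction.norm_le (by positivity)).2 fun y => ?_
        have hlip : ‖ψ (y - z.1) - ψ (y - z₀.1)‖ ≤ A * |z.1 - z₀.1| := by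
          have := Convex.norm_image_sub_le_of_norm_deriv_le (f := ψ) (s := Set.univ) (C := A)
            (x := y - z₀.1) (y := y - z.1) (fun t _ => (ψ.hasDerivAt t).differentiableAt)
            (fun t _ => by
              have := (monomialCLM 0 0 (SchwartzMap.derivCLM ℂ ℂ ψ)).norm_coe_le_norm t
              simpa [monomialCLM_apply, SchwartzMap.derivCLM_apply] using this)
            convex_univ trivial trivial
          refine this.trans (le_of_eq ?_)
          rw [Real.norm_eq_abs, abs_sub_comm]
          congr 2
          ring
        -- The factor `|y|` in the Lipschitz bound for characters is absorbed by the decay of `ψ`.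
        have hpos : |y| * ‖ψ (y - z.1)‖ ≤ B + |z.1| * D := by
          have h1 := (monomialCLM 0 0 (positionCLM ψ)).norm_coe_le_norm (y - z.1)
          have h2 := (monomialCLM 0 0 ψ).norm_coe_le_norm (y - z.1)
          simp only [monomialCLM_apply, positionCLM_apply, pow_zero, one_mul, iteratedDeriv_zero,
            norm_mul, Complex.norm_real, Real.norm_eq_abs] at h1 h2
          have h3 : |y| ≤ |y - z.1| + |z.1| := by
            simpa using abs_add_le (y - z.1) z.1
          calc |y| * ‖ψ (y - z.1)‖ ≤ (|y - z.1| + |z.1|) * ‖ψ (y - z.1)‖ := by gcongr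
            _ = |y - z.1| * ‖ψ (y - z.1)‖ + |z.1| * ‖ψ (y - z.1)‖ := by ring
            _ ≤ _ := by gcongr
        have e : (monomialCLM 0 0 (tfShift z.1 z.2 ψ) - monomialCLM 0 0 (tfShift z₀.1 z₀.2 ψ)) y
            = (modChar z.2 y - modChar z₀.2 y) * ψ (y - z.1)
              + modChar z₀.2 y * (ψ (y - z.1) - ψ (y - z₀.1)) := by
          simp only [BoundedContinuousFunction.coe_sub, Pi.sub_apply, monomialCLM_apply, pow_zero,
            one_mul, iteratedDeriv_zero, tfShift_apply]
          ring
        rw [e]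
        refine (norm_add_le _ _).trans ?_
        rw [norm_mul, norm_mul, modChar_norm, one_mul]
        refine add_le_add ?_ hlip
        calc _ ≤ (2 * Real.pi * |z.2 - z₀.2| * |y|) * ‖ψ (y - z.1)‖ := by
              gcongr
              exact norm_modChar_sub_le _ _ _
          _ = 2 * Real.pi * |z.2 - z₀.2| * (|y| * ‖ψ (y - z.1)‖) := by ring
          _ ≤ _ := by gcongr
      refine squeeze_zero (fun _ => norm_nonneg _) hbound ?_
      have hc : Continuous fun z : ℝ × ℝ =>
          2 * Real.pi * |z.2 - z₀.2| * (B + |z.1| * D) + A * |z.1 - z₀.1| := by fun_prop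
      simpa using hc.tendsto z₀
    | succ k ih =>
      simp only [monomialCLM_succ_left, positionCLM_tfShift, map_add, map_smul]
      exact ((Complex.continuous_ofReal.comp continuous_fst).smul (ih ψ)).add (ih _)
  | succ l ih =>
    simp only [monomialCLM_succ_right, derivCLM_tfShift, map_add, map_smul]
    have hc : Continuous fun z : ℝ × ℝ => ((2 * Real.pi * z.2 : ℝ) : ℂ) * Complex.I := by fun_prop
    exact (hc.smul (ih ψ)).add (ih _)

theorem stft_eq (ψ : 𝓢(ℝ, ℂ)) (f : 𝓢'(ℝ, ℂ)) (z : ℝ × ℝ) :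
    stft ψ f z = f (tfShift z.1 (-z.2) (conjSchwartz ψ)) := by
  rw [stft, bracket, conjSchwartz_tfShift]

theorem continuous_stft (ψ : 𝓢(ℝ, ℂ)) (f : 𝓢'(ℝ, ℂ)) : Continuous (stft ψ f) := by
  obtain ⟨s, L, hL⟩ := exists_factor_monomialCLM f
  have hJ : Continuous fun z : ℝ × ℝ => fun i : s => monomialCLM i.1.1 i.1.2
      (tfShift z.1 (-z.2) (conjSchwartz ψ)) :=
    continuous_pi fun i => (continuous_monomialCLM_tfShift i.1.1 i.1.2 (conjSchwartz ψ)).comp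
      (g := fun z : ℝ × ℝ => monomialCLM i.1.1 i.1.2 (tfShift z.1 z.2 (conjSchwartz ψ)))
      (f := fun z : ℝ × ℝ => (z.1, -z.2)) (continuous_fst.prodMk continuous_snd.neg)
  refine (L.continuous.comp hJ).congr fun z => ?_
  rw [stft_eq, hL]
  rfl

/-- Superpositions of time-frequency shifts with rapidly decaying coefficients are Schwartz
functions, and brackets with them are computed under the integral. -/
theorem exists_schwartz_superposition (ψ : 𝓢(ℝ, ℂ)) {a : ℝ × ℝ → ℂ}
    (hm : AEStronglyMeasurable a)
    (ha : ∀ k l : ℕ, Integrable fun z => (1 + |z.1|) ^ k * (1 + |z.2|) ^ l * ‖a z‖) :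
    ∃ Φ : 𝓢(ℝ, ℂ), (∀ y, Φ y = ∫ z, a z * tfShift z.1 z.2 ψ y) ∧
      ∀ f : 𝓢'(ℝ, ℂ), bracket f Φ = ∫ z, conj (a z) * stft ψ f z := by
  obtain ⟨Φ, hΦ, hf⟩ := exists_schwartz_integral (μ := (volume : Measure (ℝ × ℝ)))
    -- The bracket conjugates its second slot, so the conjugated superposition is integrated and
    -- conjugated back at the end.
    (fun z => conj (a z) • tfShift z.1 (-z.2) (conjSchwartz ψ)) (by
      intro k l
      obtain ⟨C, hC0, hC⟩ := exists_norm_monomialCLM_tfShift_le k l (conjSchwartz ψ)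
      simp only [map_smul]
      refine ((ha k l).const_mul C).mono' ?_ (Eventually.of_forall fun z => ?_)
      · refine AEStronglyMeasurable.smul
          (Complex.continuous_conj.comp_aestronglyMeasurable hm) ?_
        exact ((continuous_monomialCLM_tfShift k l (conjSchwartz ψ)).comp
          (continuous_fst.prodMk continuous_snd.neg)).aestronglyMeasurable
      · rw [norm_smul, RCLike.norm_conj]
        have := hC z.1 (-z.2)
        rw [abs_neg] at this
        calc _ ≤ ‖a z‖ * (C * ((1 + |z.1|) ^ k * (1 + |z.2|) ^ l)) := by gcongr
          _ = _ := by ring)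
  refine ⟨conjSchwartz Φ, fun y => ?_, fun f => ?_⟩
  · rw [conjSchwartz_apply, hΦ, ← integral_conj]
    refine integral_congr_ae (Eventually.of_forall fun z => ?_)
    simp [tfShift_apply, conj_modChar, conjSchwartz_apply]
  · rw [bracket, conjSchwartz_conjSchwartz, hf]
    refine integral_congr_ae (Eventually.of_forall fun z => ?_)
    simp [stft_eq]

/-! ### The short-time Fourier transform of functions -/

theorem stft_coe_schwartz (ψ φ : 𝓢(ℝ, ℂ)) (z : ℝ × ℝ) :
    stft ψ (φ : 𝓢'(ℝ, ℂ)) z = ∫ y, conj (tfShift z.1 z.2 ψ y) * φ y := by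
  rw [stft, bracket, SchwartzMap.coe_apply]
  rfl

theorem stft_coe_lp (ψ : 𝓢(ℝ, ℂ)) (h : Lp ℂ 2 (volume : Measure ℝ)) (z : ℝ × ℝ) :
    stft ψ (h : 𝓢'(ℝ, ℂ)) z = ∫ y, conj (tfShift z.1 z.2 ψ y) * h y := by
  rw [stft, bracket, Lp.toTemperedDistribution_apply]
  rfl

theorem conjSchwartz_smul_add (c : ℂ) (φ χ : 𝓢(ℝ, ℂ)) :
    conjSchwartz (c • φ + χ) = conj c • conjSchwartz φ + conjSchwartz χ := by
  ext y
  simp [conjSchwartz_apply]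

/-- Multiplication by the real variable `y` is symmetric for the bracket, so it passes from the
shifted window to `φ`; commuting it with the shift produces `z.1`. -/
theorem mul_stft_position (ψ φ : 𝓢(ℝ, ℂ)) (z : ℝ × ℝ) :
    (z.1 : ℂ) * stft ψ (φ : 𝓢'(ℝ, ℂ)) z
      = stft ψ (positionCLM φ : 𝓢'(ℝ, ℂ)) z - stft (positionCLM ψ) (φ : 𝓢'(ℝ, ℂ)) z := by
  have h1 : (φ : 𝓢'(ℝ, ℂ)) (conjSchwartz (positionCLM (tfShift z.1 z.2 ψ)))
      = stft ψ (positionCLM φ : 𝓢'(ℝ, ℂ)) z := by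
    rw [stft_coe_schwartz, SchwartzMap.coe_apply]
    refine integral_congr_ae (Eventually.of_forall fun y => ?_)
    simp only [conjSchwartz_apply, positionCLM_apply, map_mul, Complex.conj_ofReal, smul_eq_mul]
    ring
  rw [← h1, positionCLM_tfShift, conjSchwartz_smul_add, map_add, map_smul, Complex.conj_ofReal,
    smul_eq_mul]
  simp only [stft, bracket]
  ring

/-- The analogue for the derivative, which is antisymmetric by integration by parts. -/
theorem mul_stft_frequency (ψ φ : 𝓢(ℝ, ℂ)) (z : ℝ × ℝ) :
    ((2 * Real.pi * z.2 : ℝ) : ℂ) * Complex.I * stft ψ (φ : 𝓢'(ℝ, ℂ)) z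
      = stft ψ (SchwartzMap.derivCLM ℂ ℂ φ : 𝓢'(ℝ, ℂ)) z
        + stft (SchwartzMap.derivCLM ℂ ℂ ψ) (φ : 𝓢'(ℝ, ℂ)) z := by
  have h1 : (φ : 𝓢'(ℝ, ℂ)) (conjSchwartz (SchwartzMap.derivCLM ℂ ℂ (tfShift z.1 z.2 ψ)))
      = - stft ψ (SchwartzMap.derivCLM ℂ ℂ φ : 𝓢'(ℝ, ℂ)) z := by
    rw [stft_coe_schwartz, SchwartzMap.coe_apply]
    have hd : ∀ y, conj (deriv (tfShift z.1 z.2 ψ) y)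
        = deriv (conjSchwartz (tfShift z.1 z.2 ψ)) y := fun y =>
      (((tfShift z.1 z.2 ψ).hasDerivAt y).star.deriv).symm
    have := SchwartzMap.integral_mul_deriv_eq_neg_deriv_mul (conjSchwartz (tfShift z.1 z.2 ψ)) φ
    simp only [conjSchwartz_apply, SchwartzMap.derivCLM_apply, smul_eq_mul, hd] at this ⊢
    rw [this, neg_neg]
  rw [derivCLM_tfShift, conjSchwartz_smul_add, map_add, map_smul, smul_eq_mul, map_mul,
    Complex.conj_ofReal, Complex.conj_I] at h1
  simp only [stft, bracket] at h1 ⊢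
  linear_combination (-1 : ℂ) * h1

/-- Rapid decay of the short-time Fourier transform of a Schwartz function. -/
theorem exists_stft_decay (k l : ℕ) (ψ φ : 𝓢(ℝ, ℂ)) :
    ∃ C : ℝ, ∀ z : ℝ × ℝ,
      (1 + |z.1|) ^ k * (1 + |z.2|) ^ l * ‖stft ψ (φ : 𝓢'(ℝ, ℂ)) z‖ ≤ C := by
  induction l generalizing ψ φ with
  | zero =>
    induction k generalizing ψ φ with
    | zero =>
      refine ⟨∫ y, ‖monomialCLM 0 0 ψ‖ * ‖φ y‖, fun z => ?_⟩
      rw [pow_zero, pow_zero, one_mul, one_mul, stft_coe_schwartz]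
      refine norm_integral_le_of_norm_le (φ.integrable.norm.const_mul _)
        (Eventually.of_forall fun y => ?_)
      rw [norm_mul, RCLike.norm_conj, tfShift_apply, norm_mul, modChar_norm, one_mul]
      gcongr
      have := (monomialCLM 0 0 ψ).norm_coe_le_norm (y - z.1)
      simpa [monomialCLM_apply] using this
    | succ k ih =>
      obtain ⟨C₁, h₁⟩ := ih ψ φ
      obtain ⟨C₂, h₂⟩ := ih ψ (positionCLM φ)
      obtain ⟨C₃, h₃⟩ := ih (positionCLM ψ) φ
      refine ⟨C₁ + (C₂ + C₃), fun z => ?_⟩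
      have h : |z.1| * ‖stft ψ (φ : 𝓢'(ℝ, ℂ)) z‖ ≤ ‖stft ψ (positionCLM φ : 𝓢'(ℝ, ℂ)) z‖
          + ‖stft (positionCLM ψ) (φ : 𝓢'(ℝ, ℂ)) z‖ := by
        have := norm_sub_le (stft ψ (positionCLM φ : 𝓢'(ℝ, ℂ)) z)
          (stft (positionCLM ψ) (φ : 𝓢'(ℝ, ℂ)) z)
        rwa [← mul_stft_position, norm_mul, Complex.norm_real, Real.norm_eq_abs] at this
      set P := (1 + |z.1|) ^ k * (1 + |z.2|) ^ 0 with hP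
      have hP0 : 0 ≤ P := by positivity
      have e : (1 + |z.1|) ^ (k + 1) * (1 + |z.2|) ^ 0 * ‖stft ψ (φ : 𝓢'(ℝ, ℂ)) z‖
          = P * ‖stft ψ (φ : 𝓢'(ℝ, ℂ)) z‖ + P * (|z.1| * ‖stft ψ (φ : 𝓢'(ℝ, ℂ)) z‖) := by
        rw [hP]; ring
      rw [e]
      refine add_le_add (h₁ z) ((mul_le_mul_of_nonneg_left h hP0).trans ?_)
      rw [mul_add]
      exact add_le_add (h₂ z) (h₃ z)
  | succ l ih =>
    obtain ⟨C₁, h₁⟩ := ih ψ φ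
    obtain ⟨C₂, h₂⟩ := ih ψ (SchwartzMap.derivCLM ℂ ℂ φ)
    obtain ⟨C₃, h₃⟩ := ih (SchwartzMap.derivCLM ℂ ℂ ψ) φ
    refine ⟨C₁ + (C₂ + C₃), fun z => ?_⟩
    have h : |z.2| * ‖stft ψ (φ : 𝓢'(ℝ, ℂ)) z‖
        ≤ ‖stft ψ (SchwartzMap.derivCLM ℂ ℂ φ : 𝓢'(ℝ, ℂ)) z‖
          + ‖stft (SchwartzMap.derivCLM ℂ ℂ ψ) (φ : 𝓢'(ℝ, ℂ)) z‖ := by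
      have := norm_add_le (stft ψ (SchwartzMap.derivCLM ℂ ℂ φ : 𝓢'(ℝ, ℂ)) z)
        (stft (SchwartzMap.derivCLM ℂ ℂ ψ) (φ : 𝓢'(ℝ, ℂ)) z)
      rw [← mul_stft_frequency, norm_mul, norm_mul, Complex.norm_I, mul_one, Complex.norm_real,
        Real.norm_eq_abs, abs_mul, abs_of_pos Real.two_pi_pos] at this
      refine le_trans ?_ this
      gcongr
      exact le_mul_of_one_le_left (abs_nonneg _) (by linarith [Real.pi_gt_three])
    set P := (1 + |z.1|) ^ k * (1 + |z.2|) ^ l with hP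
    have hP0 : 0 ≤ P := by positivity
    have e : (1 + |z.1|) ^ k * (1 + |z.2|) ^ (l + 1) * ‖stft ψ (φ : 𝓢'(ℝ, ℂ)) z‖
        = P * ‖stft ψ (φ : 𝓢'(ℝ, ℂ)) z‖ + P * (|z.2| * ‖stft ψ (φ : 𝓢'(ℝ, ℂ)) z‖) := by
      rw [hP]; ring
    rw [e]
    refine add_le_add (h₁ z) ((mul_le_mul_of_nonneg_left h hP0).trans ?_)
    rw [mul_add]
    exact add_le_add (h₂ z) (h₃ z)

theorem integrable_decayWeight : Integrable decayWeight := by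
  have h : Integrable fun x : ℝ => ((1 + |x|) ^ 2)⁻¹ := by
    have := integrable_one_add_norm (E := ℝ) (μ := volume) (r := 2) (by simp)
    refine this.congr (Eventually.of_forall fun x => ?_)
    simp only [Real.norm_eq_abs]
    rw [Real.rpow_neg (by positivity)]
    norm_cast
  have := h.mul_prod h
  simp only [← mul_inv] at this
  exact this

theorem norm_stft_le_decayWeight (ψ φ : 𝓢(ℝ, ℂ)) (k l : ℕ) :
    ∃ C : ℝ, 0 ≤ C ∧ ∀ z : ℝ × ℝ,
      (1 + |z.1|) ^ k * (1 + |z.2|) ^ l * ‖stft ψ (φ : 𝓢'(ℝ, ℂ)) z‖ ≤ C * decayWeight z := by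
  -- Two extra powers in each variable pay for the weight.
  obtain ⟨C, hC⟩ := exists_stft_decay (k + 2) (l + 2) ψ φ
  refine ⟨C, le_trans (by positivity) (hC 0), fun z => ?_⟩
  rw [decayWeight, ← div_eq_mul_inv, le_div_iff₀ (by positivity)]
  refine le_trans (le_of_eq ?_) (hC z)
  ring

theorem integrable_mul_stft_schwartz (ψ φ : 𝓢(ℝ, ℂ)) (k l : ℕ) :
    Integrable fun z : ℝ × ℝ =>
      (1 + |z.1|) ^ k * (1 + |z.2|) ^ l * ‖stft ψ (φ : 𝓢'(ℝ, ℂ)) z‖ := by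
  obtain ⟨C, -, hC⟩ := norm_stft_le_decayWeight ψ φ k l
  refine (integrable_decayWeight.const_mul C).mono' ?_ (Eventually.of_forall fun z => ?_)
  · have := (continuous_stft ψ (φ : 𝓢'(ℝ, ℂ)))
    exact Continuous.aestronglyMeasurable (by fun_prop)
  · rw [Real.norm_of_nonneg (by positivity)]
    exact hC z

theorem integrable_stft_schwartz (ψ φ : 𝓢(ℝ, ℂ)) :
    Integrable (stft ψ (φ : 𝓢'(ℝ, ℂ))) := by
  have := integrable_mul_stft_schwartz ψ φ 0 0
  simp only [pow_zero, one_mul] at this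
  exact (integrable_norm_iff (continuous_stft _ _).aestronglyMeasurable).1 this

/-! ### Reconstruction from the short-time Fourier transform -/

/-- The squared `L²` norm of a window. -/
noncomputable def windowEnergy (ψ : 𝓢(ℝ, ℂ)) : ℝ := ∫ y, ‖ψ y‖ ^ 2

theorem windowEnergy_pos {ψ : 𝓢(ℝ, ℂ)} (hψ : ψ ≠ 0) : 0 < windowEnergy ψ := by
  obtain ⟨y, hy⟩ : ∃ y, ψ y ≠ 0 := by
    by_contra! h
    exact hψ (SchwartzMap.ext fun y => by simpa using h y)
  refine integral_pos_of_integrable_nonneg_nonzero (x := y) (by fun_prop) ?_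
    (fun _ => by positivity) (by simpa using hy)
  exact (ψ.memLp 2).integrable_norm_pow two_ne_zero

-- Fourier inversion: for fixed `x`, the transform in `w` is the Fourier transform of the Schwartz
-- function `conj ψ(· - x) φ`.
open scoped FourierTransform in
theorem integral_modChar_mul_stft (ψ φ : 𝓢(ℝ, ℂ)) (x y : ℝ) :
    ∫ w, modChar w y * stft ψ (φ : 𝓢'(ℝ, ℂ)) (x, w) = conj (ψ (y - x)) * φ y := by
  let h : 𝓢(ℝ, ℂ) := SchwartzMap.smulLeftCLM ℂ (conjSchwartz (tfShift x 0 ψ)) φ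
  have hh : ∀ t, h t = conj (ψ (t - x)) * φ t := by
    intro t
    simp only [h]
    rw [SchwartzMap.smulLeftCLM_apply_apply (conjSchwartz (tfShift x 0 ψ)).hasTemperateGrowth]
    simp [conjSchwartz_apply, tfShift_apply, modChar]
  have hF : ∀ w, 𝓕 h w = stft ψ (φ : 𝓢'(ℝ, ℂ)) (x, w) := by
    intro w
    rw [SchwartzMap.fourier_coe, Real.fourier_real_eq_integral_exp_smul, stft_coe_schwartz]
    refine integral_congr_ae (Eventually.of_forall fun t => ?_)
    simp only [hh, tfShift_apply, map_mul, conj_modChar, smul_eq_mul, ← mul_assoc]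
    congr 2
    rw [modChar]
    congr 1
    push_cast
    ring
  have hinv : 𝓕⁻ (𝓕 h) = h := by simp
  rw [← hh, ← hinv, SchwartzMap.fourierInv_coe, Real.fourierInv_eq']
  refine integral_congr_ae (Eventually.of_forall fun w => ?_)
  simp only [hF, modChar, smul_eq_mul]
  congr 2
  simp
  ring

theorem integral_stft_mul_tfShift (ψ φ : 𝓢(ℝ, ℂ)) (y : ℝ) :
    ∫ z : ℝ × ℝ, stft ψ (φ : 𝓢'(ℝ, ℂ)) z * tfShift z.1 z.2 ψ y = windowEnergy ψ * φ y := by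
  have hintegrable : Integrable fun z : ℝ × ℝ =>
      stft ψ (φ : 𝓢'(ℝ, ℂ)) z * tfShift z.1 z.2 ψ y := by
    refine (integrable_stft_schwartz ψ φ).mul_bdd (c := ‖monomialCLM 0 0 ψ‖) ?_
      (Eventually.of_forall fun z => ?_)
    · have hc := (continuous_monomialCLM_tfShift 0 0 ψ)
      have := (BoundedContinuousFunction.evalCLM ℂ y).continuous.comp hc
      refine Continuous.aestronglyMeasurable (this.congr fun z => ?_)
      change monomialCLM 0 0 (tfShift z.1 z.2 ψ) y = _
      simp [monomialCLM_apply]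
    · have := ((monomialCLM 0 0 (tfShift z.1 z.2 ψ)).norm_coe_le_norm y).trans
        (norm_monomialCLM_tfShift_zero_le ψ z.1 z.2)
      simpa [monomialCLM_apply] using this
  rw [Measure.volume_eq_prod, integral_prod _ hintegrable]
  have h1 : ∀ x, ∫ w, stft ψ (φ : 𝓢'(ℝ, ℂ)) (x, w) * tfShift x w ψ y
      = ((‖ψ (y - x)‖ ^ 2 : ℝ) : ℂ) * φ y := by
    intro x
    have : ∀ w, stft ψ (φ : 𝓢'(ℝ, ℂ)) (x, w) * tfShift x w ψ y
        = ψ (y - x) * (modChar w y * stft ψ (φ : 𝓢'(ℝ, ℂ)) (x, w)) := by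
      intro w
      rw [tfShift_apply]
      ring
    simp only [this]
    rw [integral_const_mul, integral_modChar_mul_stft, ← mul_assoc, Complex.mul_conj']
    push_cast
    rfl
  simp only [h1]
  rw [integral_mul_const, integral_complex_ofReal, windowEnergy,
    integral_sub_left_eq_self (fun t => ‖ψ t‖ ^ 2)]

/-- The bracket of a tempered distribution with a Schwartz function in terms of their short-time
Fourier transforms. -/
theorem windowEnergy_mul_bracket (ψ φ : 𝓢(ℝ, ℂ)) (f : 𝓢'(ℝ, ℂ)) :
    windowEnergy ψ * bracket f φ
      = ∫ z, conj (stft ψ (φ : 𝓢'(ℝ, ℂ)) z) * stft ψ f z := by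
  obtain ⟨Φ, h1, h2⟩ := exists_schwartz_superposition ψ
    (continuous_stft ψ (φ : 𝓢'(ℝ, ℂ))).aestronglyMeasurable (integrable_mul_stft_schwartz ψ φ)
  -- Superposing the shifts of `ψ` with coefficients `Vφ` recovers `φ` up to the energy, by Fubini
  -- and Fourier inversion.
  have hΦ : Φ = (windowEnergy ψ : ℂ) • φ := by
    ext y
    rw [h1, integral_stft_mul_tfShift]
    rfl
  rw [← h2, hΦ, bracket, bracket]
  have := conjSchwartz_smul_add (windowEnergy ψ : ℂ) φ 0
  rw [add_zero] at this
  have h0 : conjSchwartz 0 = 0 := by ext y; simp [conjSchwartz_apply]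
  rw [this, h0, add_zero, Complex.conj_ofReal, map_smul, smul_eq_mul]

/-! ### Covariance -/

/-- Time-frequency shifts compose up to a unimodular phase. A bare function `F` lets this serve both
Schwartz functions and `L²` classes. -/
theorem norm_integral_tfShift_mul (ψ : 𝓢(ℝ, ℂ)) (F : ℝ → ℂ) (u z : ℝ × ℝ) :
    ‖∫ y, conj (tfShift z.1 z.2 ψ y) * (modChar u.2 y * F (y - u.1))‖
      = ‖∫ y, conj (tfShift (z - u).1 (z - u).2 ψ y) * F y‖ := by
  have h : ∀ y, conj (tfShift z.1 z.2 ψ y) * (modChar u.2 y * F (y - u.1))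
      = modChar (u.2 - z.2) u.1 *
        (conj (tfShift (z - u).1 (z - u).2 ψ (y - u.1)) * F (y - u.1)) := by
    intro y
    have e1 : modChar (-z.2) y * modChar u.2 y
        = modChar (u.2 - z.2) u.1 * modChar (u.2 - z.2) (y - u.1) := by
      rw [← modChar_add, ← modChar_add_right]
      congr 1 <;> ring
    simp only [tfShift_apply, map_mul, conj_modChar, Prod.fst_sub, Prod.snd_sub, neg_sub]
    rw [show y - u.1 - (z.1 - u.1) = y - z.1 by ring]
    linear_combination conj (ψ (y - z.1)) * F (y - u.1) * e1
  simp only [h]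
  rw [integral_const_mul, norm_mul, modChar_norm, one_mul,
    integral_sub_right_eq_self (fun y => conj (tfShift (z - u).1 (z - u).2 ψ y) * F y)]

theorem norm_stft_tfShift (ψ φ : 𝓢(ℝ, ℂ)) (u z : ℝ × ℝ) :
    ‖stft ψ (tfShift u.1 u.2 φ : 𝓢'(ℝ, ℂ)) z‖ = ‖stft ψ (φ : 𝓢'(ℝ, ℂ)) (z - u)‖ := by
  rw [stft_coe_schwartz, stft_coe_schwartz, ← norm_integral_tfShift_mul]
  simp only [tfShift_apply u.1 u.2 φ]

theorem norm_stft_tfShiftL2 (ψ : 𝓢(ℝ, ℂ)) (h : Lp ℂ 2 (volume : Measure ℝ)) (u z : ℝ × ℝ) :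
    ‖stft ψ (tfShiftL2 u.1 u.2 h : 𝓢'(ℝ, ℂ)) z‖ = ‖stft ψ (h : 𝓢'(ℝ, ℂ)) (z - u)‖ := by
  rw [stft_coe_lp, stft_coe_lp, ← norm_integral_tfShift_mul]
  congr 1
  refine integral_congr_ae ?_
  filter_upwards [(memLp_tfShift u.1 u.2 h).coeFn_toLp] with y hy
  rw [tfShiftL2, hy]

theorem stft_tfShift_symm (ψ : 𝓢(ℝ, ℂ)) (u z : ℝ × ℝ) :
    conj (stft ψ (tfShift u.1 u.2 ψ : 𝓢'(ℝ, ℂ)) z)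
      = stft ψ (tfShift z.1 z.2 ψ : 𝓢'(ℝ, ℂ)) u := by
  rw [stft_coe_schwartz, stft_coe_schwartz, ← integral_conj]
  refine integral_congr_ae (Eventually.of_forall fun y => ?_)
  simp only [map_mul, RCLike.conj_conj]
  ring

theorem decayWeight_neg (z : ℝ × ℝ) : decayWeight (-z) = decayWeight z := by
  simp [decayWeight]

/-- The reproducing kernel of the short-time Fourier transform decays rapidly off the diagonal. -/
theorem exists_enorm_stft_tfShift_le (ψ : 𝓢(ℝ, ℂ)) :
    ∃ C : ℝ≥0∞, C ≠ ∞ ∧ ∀ u z : ℝ × ℝ,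
      ‖stft ψ (tfShift u.1 u.2 ψ : 𝓢'(ℝ, ℂ)) z‖ₑ ≤ C * ENNReal.ofReal (decayWeight (u - z)) := by
  obtain ⟨C, hC0, hC⟩ := norm_stft_le_decayWeight ψ ψ 0 0
  refine ⟨ENNReal.ofReal C, ENNReal.ofReal_ne_top, fun u z => ?_⟩
  rw [← ENNReal.ofReal_mul hC0, ← ofReal_norm, norm_stft_tfShift, ← decayWeight_neg,
    neg_sub]
  exact ENNReal.ofReal_le_ofReal (by simpa using hC (z - u))

/-- The reproducing formula: `windowEnergy_mul_bracket` tested on a shifted window. -/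
theorem windowEnergy_mul_stft (ψ : 𝓢(ℝ, ℂ)) (f : 𝓢'(ℝ, ℂ)) (u : ℝ × ℝ) :
    windowEnergy ψ * stft ψ f u
      = ∫ z, stft ψ (tfShift z.1 z.2 ψ : 𝓢'(ℝ, ℂ)) u * stft ψ f z := by
  rw [stft, windowEnergy_mul_bracket]
  simp only [stft_tfShift_symm]

/-! ### Modulation norms and local suprema -/

theorem modNorm_ofReal (ψ : 𝓢(ℝ, ℂ)) {p : ℝ} (hp : 0 < p) (f : 𝓢'(ℝ, ℂ)) :
    modNorm ψ (ENNReal.ofReal p) f = (∫⁻ z, ‖stft ψ f z‖ₑ ^ p) ^ (1 / p) := by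
  rw [modNorm, eLpNorm_eq_lintegral_rpow_enorm_toReal (by simpa using hp) ENNReal.ofReal_ne_top,
    ENNReal.toReal_ofReal hp.le]

theorem stft_sub (ψ : 𝓢(ℝ, ℂ)) (f h : 𝓢'(ℝ, ℂ)) (z : ℝ × ℝ) :
    stft ψ (f - h) z = stft ψ f z - stft ψ h z := by
  simp [stft, bracket]

theorem stft_smul (ψ : 𝓢(ℝ, ℂ)) (c : ℂ) (f : 𝓢'(ℝ, ℂ)) (z : ℝ × ℝ) :
    stft ψ (c • f) z = c * stft ψ f z := by
  simp [stft, bracket]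

theorem stft_sum {ι : Type*} (ψ : 𝓢(ℝ, ℂ)) (s : Finset ι) (u : ι → 𝓢'(ℝ, ℂ)) (z : ℝ × ℝ) :
    stft ψ (∑ i ∈ s, u i) z = ∑ i ∈ s, stft ψ (u i) z := by
  simp [stft, bracket]

theorem measurable_enorm_stft (ψ : 𝓢(ℝ, ℂ)) (f : 𝓢'(ℝ, ℂ)) :
    Measurable fun z => ‖stft ψ f z‖ₑ :=
  (continuous_stft ψ f).enorm.measurable

/-- The reproducing formula turns a superposition into a function which is dominated by a
convolution with a decaying kernel. -/
theorem exists_enorm_kernel_integral_le {ψ : 𝓢(ℝ, ℂ)} :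
    ∃ C : ℝ≥0∞, C ≠ ∞ ∧ ∀ (a : ℝ × ℝ → ℂ) (u : ℝ × ℝ),
      ∫⁻ z, ‖stft ψ (tfShift z.1 z.2 ψ : 𝓢'(ℝ, ℂ)) u * a z‖ₑ
        ≤ C * ∫⁻ z, ‖a z‖ₑ * ENNReal.ofReal (decayWeight (u - z)) := by
  obtain ⟨C, hC, h⟩ := exists_enorm_stft_tfShift_le ψ
  refine ⟨C, hC, fun a u => ?_⟩
  rw [← lintegral_const_mul' _ _ hC]
  refine lintegral_mono fun z => ?_
  rw [enorm_mul, mul_left_comm, mul_comm]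
  gcongr
  rw [← decayWeight_neg, neg_sub]
  exact h z u

theorem inv_windowEnergy_mul_integral {ψ : 𝓢(ℝ, ℂ)} (hψ : ψ ≠ 0) (f : 𝓢'(ℝ, ℂ)) (u : ℝ × ℝ) :
    stft ψ f u = (windowEnergy ψ : ℂ)⁻¹ *
      ∫ z, stft ψ (tfShift z.1 z.2 ψ : 𝓢'(ℝ, ℂ)) u * stft ψ f z := by
  have h : (windowEnergy ψ : ℂ) ≠ 0 := by exact_mod_cast (windowEnergy_pos hψ).ne'
  rw [← windowEnergy_mul_stft, inv_mul_cancel_left₀ h]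

/-- The reproducing kernel operator maps `L^p` functions to functions with `p`-summable local
suprema. -/
theorem exists_lpSum_cellSup_kernel_le {ψ : 𝓢(ℝ, ℂ)} {α β : ℝ} (hα : 0 < α) (hβ : 0 < β)
    {p : ℝ} (hp : 1 ≤ p) :
    ∃ C : ℝ≥0∞, C ≠ ∞ ∧ ∀ a : ℝ × ℝ → ℂ, AEMeasurable (fun z => ‖a z‖ₑ) →
      lpSum p (cellSup α β fun u =>
          ∫⁻ z, ‖stft ψ (tfShift z.1 z.2 ψ : 𝓢'(ℝ, ℂ)) u * a z‖ₑ)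
        ≤ C * (∫⁻ z, ‖a z‖ₑ ^ p) ^ (1 / p) := by
  obtain ⟨C₁, hC₁, h₁⟩ := exists_enorm_kernel_integral_le (ψ := ψ)
  obtain ⟨C₂, hC₂, h₂⟩ := exists_lpSum_cellSup_le hα hβ hp
  exact ⟨C₂ * C₁, by finiteness, fun a ha => h₂ _ _ _ ha (h₁ a)⟩

theorem lpSum_cellSup_const_mul_le {α β p : ℝ} (hp : 0 < p) (c : ℝ≥0∞) {F G : ℝ × ℝ → ℝ≥0∞}
    (h : ∀ z, F z ≤ c * G z) :
    lpSum p (cellSup α β F) ≤ c * lpSum p (cellSup α β G) := by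
  rw [← lpSum_const_mul hp]
  refine lpSum_mono hp.le fun i => iSup₂_le fun z hz => (h z).trans ?_
  gcongr
  exact le_cellSup G hz

theorem enorm_inv_mul_integral_le (c : ℂ) {a : ℝ × ℝ → ℂ} :
    ‖c * ∫ z, a z‖ₑ ≤ ‖c‖ₑ * ∫⁻ z, ‖a z‖ₑ := by
  rw [enorm_mul]
  gcongr
  exact enorm_integral_le_lintegral_enorm _

/-- `Vf` reproduces itself under a rapidly decaying kernel, and this smoothing upgrades `L^p`
integrability to `p`-summable local suprema. -/
theorem exists_lpSum_cellSup_stft_le {ψ : 𝓢(ℝ, ℂ)} (hψ : ψ ≠ 0) {α β : ℝ} (hα : 0 < α)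
    (hβ : 0 < β) {p : ℝ} (hp : 1 ≤ p) :
    ∃ C : ℝ≥0∞, C ≠ ∞ ∧ ∀ f : 𝓢'(ℝ, ℂ),
      lpSum p (cellSup α β fun z => ‖stft ψ f z‖ₑ) ≤ C * modNorm ψ (ENNReal.ofReal p) f := by
  have hp0 : 0 < p := by linarith
  obtain ⟨C, hC, h⟩ := exists_lpSum_cellSup_kernel_le (ψ := ψ) hα hβ hp
  refine ⟨‖(windowEnergy ψ : ℂ)⁻¹‖ₑ * C, by finiteness, fun f => ?_⟩
  rw [modNorm_ofReal ψ hp0, mul_assoc]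
  refine (lpSum_cellSup_const_mul_le hp0 ‖(windowEnergy ψ : ℂ)⁻¹‖ₑ fun z => ?_).trans
    (mul_le_mul_right (h (stft ψ f) (measurable_enorm_stft ψ f).aemeasurable) _)
  rw [inv_windowEnergy_mul_integral hψ f z]
  exact enorm_inv_mul_integral_le _

theorem lpSum_cellSup_stft_ne_top {ψ : 𝓢(ℝ, ℂ)} (hψ : ψ ≠ 0) {α β : ℝ} (hα : 0 < α) (hβ : 0 < β)
    {p : ℝ} (hp : 1 ≤ p) {f : 𝓢'(ℝ, ℂ)} (hf : MemModulation ψ (ENNReal.ofReal p) f) :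
    lpSum p (cellSup α β fun z => ‖stft ψ f z‖ₑ) ≠ ∞ := by
  obtain ⟨C, hC, h⟩ := exists_lpSum_cellSup_stft_le hψ hα hβ hp
  have := hf.ne
  exact ne_top_of_le_ne_top (by finiteness) (h f)

/-! ### Density of the Schwartz functions -/

theorem conj_bracket_coe (φ χ : 𝓢(ℝ, ℂ)) :
    conj (bracket (φ : 𝓢'(ℝ, ℂ)) χ) = bracket (χ : 𝓢'(ℝ, ℂ)) φ := by
  rw [bracket, bracket, SchwartzMap.coe_apply, SchwartzMap.coe_apply, ← integral_conj]
  refine integral_congr_ae (Eventually.of_forall fun y => ?_)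
  simp [conjSchwartz_apply, mul_comm]

/-- Cutting `Vh` off to a ball gives compactly supported coefficients, so the superposition is
Schwartz. Divided by the energy, these are the approximants of `h`. -/
theorem exists_schwartz_truncation (ψ : 𝓢(ℝ, ℂ)) (h : 𝓢'(ℝ, ℂ)) (R : ℝ) :
    ∃ Φ : 𝓢(ℝ, ℂ), ∀ u, stft ψ (Φ : 𝓢'(ℝ, ℂ)) u
      = ∫ z, stft ψ (tfShift z.1 z.2 ψ : 𝓢'(ℝ, ℂ)) u *
          (Metric.closedBall (0 : ℝ × ℝ) R).indicator (stft ψ h) z := by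
  have hc := continuous_stft ψ h
  obtain ⟨Φ, -, hΦ⟩ := exists_schwartz_superposition ψ
    (a := (Metric.closedBall (0 : ℝ × ℝ) R).indicator (stft ψ h))
    (hc.aestronglyMeasurable.indicator Metric.isClosed_closedBall.measurableSet) (by
      intro k l
      have hcont : Continuous fun z : ℝ × ℝ =>
          (1 + |z.1|) ^ k * (1 + |z.2|) ^ l * ‖stft ψ h z‖ := by fun_prop
      refine ((hcont.continuousOn.integrableOn_compact
        (isCompact_closedBall (0 : ℝ × ℝ) R)).integrable_indicator
        Metric.isClosed_closedBall.measurableSet).congr (Eventually.of_forall fun z => ?_)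
      by_cases hz : z ∈ Metric.closedBall (0 : ℝ × ℝ) R <;> simp [hz])
  refine ⟨Φ, fun u => ?_⟩
  rw [stft, ← conj_bracket_coe, hΦ, ← integral_conj]
  refine integral_congr_ae (Eventually.of_forall fun z => ?_)
  simp only [map_mul, RCLike.conj_conj, stft_tfShift_symm]
  ring

theorem tendsto_lintegral_sub_indicator_closedBall {a : ℝ × ℝ → ℂ} (ha : Measurable a) {p : ℝ}
    (hp : 0 < p) (hfin : ∫⁻ z, ‖a z‖ₑ ^ p ≠ ∞) :
    Tendsto (fun n : ℕ =>
      (∫⁻ z, ‖a z - (Metric.closedBall (0 : ℝ × ℝ) n).indicator a z‖ₑ ^ p) ^ (1 / p))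
      atTop (𝓝 0) := by
  have h1 := tendsto_lintegral_of_dominated_convergence (μ := volume)
    (F := fun (n : ℕ) z => ‖a z - (Metric.closedBall (0 : ℝ × ℝ) n).indicator a z‖ₑ ^ p)
    (f := fun _ => 0) (fun z => ‖a z‖ₑ ^ p)
    (fun n => ((ha.sub (ha.indicator
      Metric.isClosed_closedBall.measurableSet)).enorm).pow_const p)
    (fun n => Eventually.of_forall fun z => by
      refine ENNReal.rpow_le_rpow ?_ hp.le
      by_cases hz : z ∈ Metric.closedBall (0 : ℝ × ℝ) n <;> simp [hz]) hfin
    (Eventually.of_forall fun z => by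
      obtain ⟨N, hN⟩ := exists_nat_ge ‖z‖
      refine tendsto_const_nhds.congr' ?_
      filter_upwards [eventually_ge_atTop N] with n hn
      have hz : z ∈ Metric.closedBall (0 : ℝ × ℝ) n := by
        rw [mem_closedBall_zero_iff]
        exact hN.trans (by exact_mod_cast hn)
      simp [hz, hp])
  rw [lintegral_zero] at h1
  have h2 := (ENNReal.continuous_rpow_const (y := 1 / p)).tendsto 0
  rw [ENNReal.zero_rpow_of_pos (by positivity)] at h2
  exact h2.comp h1

theorem modNorm_le_lpSum {ψ : 𝓢(ℝ, ℂ)} {α β : ℝ} (hα : 0 < α) (hβ : 0 < β) {p : ℝ} (hp : 0 < p)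
    {f : 𝓢'(ℝ, ℂ)} {a : ℤ × ℤ → ℝ≥0∞} (h : ∀ i, ∀ z ∈ cell α β i, ‖stft ψ f z‖ₑ ≤ a i) :
    modNorm ψ (ENNReal.ofReal p) f
      ≤ (ENNReal.ofReal α * ENNReal.ofReal β) ^ (1 / p) * lpSum p a := by
  rw [modNorm_ofReal ψ hp]
  exact lintegral_rpow_le_lpSum_cellSup hα hβ hp h

theorem modNorm_le_lpSum_cellSup (ψ : 𝓢(ℝ, ℂ)) {α β : ℝ} (hα : 0 < α) (hβ : 0 < β) {p : ℝ}
    (hp : 0 < p) (f : 𝓢'(ℝ, ℂ)) :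
    modNorm ψ (ENNReal.ofReal p) f ≤ (ENNReal.ofReal α * ENNReal.ofReal β) ^ (1 / p) *
      lpSum p (cellSup α β fun z => ‖stft ψ f z‖ₑ) :=
  modNorm_le_lpSum hα hβ hp fun _ _ hz => le_cellSup (fun z => ‖stft ψ f z‖ₑ) hz

/-- This is density of the Schwartz functions in `M^p`: the error of the truncation is the kernel
operator applied to the tail of `Vh`, which tends to zero in `L^p` since `p` is finite. -/
theorem schwartzApprox_neBot {ψ : 𝓢(ℝ, ℂ)} (hψ : ψ ≠ 0) {p : ℝ} (hp : 1 ≤ p) {h : 𝓢'(ℝ, ℂ)}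
    (hh : MemModulation ψ (ENNReal.ofReal p) h) :
    (schwartzApprox ψ (ENNReal.ofReal p) h).NeBot := by
  have hp0 : 0 < p := by linarith
  obtain ⟨C, hC, hker⟩ := exists_lpSum_cellSup_kernel_le (ψ := ψ) one_pos one_pos hp
  choose Φ hΦ using fun n : ℕ => exists_schwartz_truncation ψ h n
  have hE : (windowEnergy ψ : ℂ) ≠ 0 := by exact_mod_cast (windowEnergy_pos hψ).ne'
  obtain ⟨χ, hχ⟩ : ∃ χ : ℕ → 𝓢(ℝ, ℂ), ∀ n, χ n = (windowEnergy ψ : ℂ)⁻¹ • Φ n := ⟨_, fun _ => rfl⟩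
  set B : ℕ → Set (ℝ × ℝ) := fun n => Metric.closedBall (0 : ℝ × ℝ) n with hB
  have hcont := continuous_stft ψ h
  have hfin : ∫⁻ z, ‖stft ψ h z‖ₑ ^ p ≠ ∞ := by
    have := hh.ne
    rw [modNorm_ofReal ψ hp0] at this
    intro htop
    exact this (by rw [htop, ENNReal.top_rpow_of_pos (by positivity)])
  have hkcont : ∀ u, Continuous fun z : ℝ × ℝ => stft ψ (tfShift z.1 z.2 ψ : 𝓢'(ℝ, ℂ)) u := by
    intro u
    simp only [← stft_tfShift_symm ψ u]
    exact Complex.continuous_conj.comp (continuous_stft _ _)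
  have hintegrable : ∀ u, Integrable fun z =>
      stft ψ (tfShift z.1 z.2 ψ : 𝓢'(ℝ, ℂ)) u * stft ψ h z := by
    intro u
    refine ⟨((hkcont u).mul hcont).aestronglyMeasurable, ?_⟩
    refine lt_of_le_of_lt ((le_cellSup (fun u => ∫⁻ z, ‖stft ψ (tfShift z.1 z.2 ψ : 𝓢'(ℝ, ℂ)) u *
      stft ψ h z‖ₑ) (mem_cell_self 1 1 u)).trans ((le_lpSum hp0 _ _).trans
      (hker (stft ψ h) (measurable_enorm_stft ψ h).aemeasurable))) ?_
    have : (∫⁻ z, ‖stft ψ h z‖ₑ ^ p) ^ (1 / p) ≠ ∞ :=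
      ENNReal.rpow_ne_top_of_nonneg (by positivity) hfin
    exact Ne.lt_top (by finiteness)
  have hmeas : ∀ n, MeasurableSet (B n) := fun n => Metric.isClosed_closedBall.measurableSet
  have hintegrable_trunc : ∀ n u, Integrable fun z =>
      stft ψ (tfShift z.1 z.2 ψ : 𝓢'(ℝ, ℂ)) u * (B n).indicator (stft ψ h) z := by
    intro n u
    refine ((hintegrable u).indicator (hmeas n)).congr (Eventually.of_forall fun z => ?_)
    by_cases hz : z ∈ B n <;> simp [hz]
  have hdiff : ∀ n u, stft ψ (h - (χ n : 𝓢'(ℝ, ℂ))) u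
      = (windowEnergy ψ : ℂ)⁻¹ * ∫ z, stft ψ (tfShift z.1 z.2 ψ : 𝓢'(ℝ, ℂ)) u *
          (stft ψ h z - (B n).indicator (stft ψ h) z) := by
    intro n u
    simp only [mul_sub]
    rw [integral_sub (hintegrable u) (hintegrable_trunc n u), mul_sub,
      ← inv_windowEnergy_mul_integral hψ, stft_sub, hχ, map_smul, stft_smul, hΦ]
  have hbound : ∀ n, modNorm ψ (ENNReal.ofReal p)
      (h - (χ n : 𝓢'(ℝ, ℂ)))
      ≤ (‖(windowEnergy ψ : ℂ)⁻¹‖ₑ * C) *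
        (∫⁻ z, ‖stft ψ h z - (B n).indicator (stft ψ h) z‖ₑ ^ p) ^ (1 / p) := by
    intro n
    refine (modNorm_le_lpSum_cellSup ψ one_pos one_pos hp0 _).trans ?_
    rw [ENNReal.ofReal_one, one_mul, ENNReal.one_rpow, one_mul, mul_assoc]
    refine (lpSum_cellSup_const_mul_le hp0 ‖(windowEnergy ψ : ℂ)⁻¹‖ₑ fun u => ?_).trans
      (mul_le_mul_right (hker (fun z => stft ψ h z - (B n).indicator (stft ψ h) z)
        (hcont.measurable.sub (hcont.measurable.indicator (hmeas n))).enorm.aemeasurable) _)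
    rw [hdiff]
    exact enorm_inv_mul_integral_le _
  have hlim : Tendsto (fun n => modNorm ψ (ENNReal.ofReal p)
      (h - (χ n : 𝓢'(ℝ, ℂ)))) atTop (𝓝 0) := by
    refine tendsto_of_tendsto_of_tendsto_of_le_of_le tendsto_const_nhds ?_ (fun _ => zero_le)
      hbound
    have := ENNReal.Tendsto.const_mul (a := ‖(windowEnergy ψ : ℂ)⁻¹‖ₑ * C)
      (tendsto_lintegral_sub_indicator_closedBall hcont.measurable hp0 hfin)
      (Or.inr (by finiteness))
    rwa [mul_zero] at this
  exact (tendsto_comap_iff.2 hlim : Tendsto χ atTop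
    (schwartzApprox ψ (ENNReal.ofReal p) h)).neBot

/-! ### The duality pairing -/

/-- The pairing `⟨f, h⟩` computed from short-time Fourier transforms. -/
noncomputable def stftPairing (ψ : 𝓢(ℝ, ℂ)) (f h : 𝓢'(ℝ, ℂ)) : ℂ :=
  (windowEnergy ψ : ℂ)⁻¹ * ∫ z, conj (stft ψ h z) * stft ψ f z

theorem lintegral_mul_translate_le {α β : ℝ} (hα : 0 < α) (hβ : 0 < β) (F H : ℝ × ℝ → ℝ≥0∞)
    (j : ℤ × ℤ) :
    ∫⁻ z, F z * H (z - latticePoint α β j) ≤ ENNReal.ofReal α * ENNReal.ofReal β *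
      ∑' i, cellSup α β F i * cellSup α β H (-(j - i)) := by
  refine lintegral_le_tsum_of_le hα hβ fun i z hz => ?_
  gcongr
  · exact le_cellSup F hz
  · rw [neg_sub]
    exact le_cellSup H (sub_latticePoint_mem_cell hα hβ hz)

theorem lpSum_lintegral_mul_translate_le {α β : ℝ} (hα : 0 < α) (hβ : 0 < β) {s p r : ℝ}
    (hs : 1 ≤ s) (hp : 1 ≤ p) (hr : 1 ≤ r) (h : 1 / r = 1 / s + 1 / p - 1)
    (F H : ℝ × ℝ → ℝ≥0∞) :
    lpSum r (fun j => ∫⁻ z, F z * H (z - latticePoint α β j))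
      ≤ ENNReal.ofReal α * ENNReal.ofReal β *
        (lpSum s (cellSup α β F) * lpSum p (cellSup α β H)) := by
  have hr0 : 0 < r := by linarith
  refine (lpSum_mono hr0.le (lintegral_mul_translate_le hα hβ F H)).trans ?_
  rw [lpSum_const_mul hr0]
  gcongr
  refine (lpSum_conv_le hs hp hr h (cellSup α β F) (fun m => cellSup α β H (-m))).trans ?_
  exact (congrArg _ (lpSum_comp_equiv p (cellSup α β H) (Equiv.neg _))).le

/-- The entry `j = 0` of the preceding bound. Local suprema allow all exponents with `1/s + 1/p >
1`, beyond conjugate pairs. -/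
theorem lintegral_mul_le_lpSum {α β : ℝ} (hα : 0 < α) (hβ : 0 < β) {s p r : ℝ}
    (hs : 1 ≤ s) (hp : 1 ≤ p) (hr : 1 ≤ r) (h : 1 / r = 1 / s + 1 / p - 1)
    (F H : ℝ × ℝ → ℝ≥0∞) :
    ∫⁻ z, F z * H z ≤ ENNReal.ofReal α * ENNReal.ofReal β *
        (lpSum s (cellSup α β F) * lpSum p (cellSup α β H)) := by
  refine le_trans (le_of_eq ?_) ((le_lpSum (by linarith)
    (fun j => ∫⁻ z, F z * H (z - latticePoint α β j)) 0).trans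
    (lpSum_lintegral_mul_translate_le hα hβ hs hp hr h F H))
  have : latticePoint α β 0 = 0 := by simp [latticePoint]
  simp [this]

theorem enorm_conj_mul (a b : ℂ) : ‖conj a * b‖ₑ = ‖b‖ₑ * ‖a‖ₑ := by
  rw [enorm_mul, RCLike.enorm_conj, mul_comm]

/-- For exponents with `1/s + 1/p ≥ 1` the bracket with `f ∈ M^s` extends continuously to `M^p`. -/
theorem tendsto_bracket_schwartzApprox {ψ : 𝓢(ℝ, ℂ)} (hψ : ψ ≠ 0) {s p r : ℝ}
    (hs : 1 ≤ s) (hp : 1 ≤ p) (hr : 1 ≤ r) (hr' : 1 / r = 1 / s + 1 / p - 1) {f h : 𝓢'(ℝ, ℂ)}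
    (hf : MemModulation ψ (ENNReal.ofReal s) f) (hh : MemModulation ψ (ENNReal.ofReal p) h) :
    Tendsto (bracket f) (schwartzApprox ψ (ENNReal.ofReal p) h) (𝓝 (stftPairing ψ f h)) := by
  have hE : (windowEnergy ψ : ℂ) ≠ 0 := by exact_mod_cast (windowEnergy_pos hψ).ne'
  set A := lpSum s (cellSup 1 1 fun z => ‖stft ψ f z‖ₑ) with hA
  have hAtop : A ≠ ∞ := lpSum_cellSup_stft_ne_top hψ one_pos one_pos hs hf
  obtain ⟨C, hC, hCle⟩ := exists_lpSum_cellSup_stft_le hψ one_pos one_pos hp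
  have hle : ∀ k : 𝓢'(ℝ, ℂ), ∫⁻ z, ‖conj (stft ψ k z) * stft ψ f z‖ₑ
      ≤ A * C * modNorm ψ (ENNReal.ofReal p) k := by
    intro k
    simp only [enorm_conj_mul]
    refine (lintegral_mul_le_lpSum one_pos one_pos hs hp hr hr' _ _).trans ?_
    rw [ENNReal.ofReal_one, one_mul, one_mul, mul_assoc]
    gcongr
    exact hCle k
  have hintegrable : ∀ k : 𝓢'(ℝ, ℂ), modNorm ψ (ENNReal.ofReal p) k < ∞ →
      Integrable fun z => conj (stft ψ k z) * stft ψ f z := by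
    intro k hk
    refine ⟨((Complex.continuous_conj.comp (continuous_stft ψ k)).mul
      (continuous_stft ψ f)).aestronglyMeasurable, (hle k).trans_lt ?_⟩
    exact ENNReal.mul_lt_top (Ne.lt_top (by finiteness)) hk
  rw [tendsto_iff_edist_tendsto_0]
  have hlim : Tendsto (fun φ : 𝓢(ℝ, ℂ) => modNorm ψ (ENNReal.ofReal p) (h - (φ : 𝓢'(ℝ, ℂ))))
      (schwartzApprox ψ (ENNReal.ofReal p) h) (𝓝 0) := tendsto_comap
  have hlim' := ENNReal.Tendsto.const_mul (a := ‖(windowEnergy ψ : ℂ)⁻¹‖ₑ * (A * C)) hlim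
    (Or.inr (by finiteness))
  rw [mul_zero] at hlim'
  refine tendsto_of_tendsto_of_tendsto_of_le_of_le' tendsto_const_nhds hlim'
    (Eventually.of_forall fun _ => zero_le) ?_
  -- Only for `φ` at finite distance from `h` do the integrals exist and subtract.
  filter_upwards [hlim.eventually (gt_mem_nhds ENNReal.zero_lt_top)] with φ hφ
  have hb : bracket f φ - stftPairing ψ f h = (-(windowEnergy ψ : ℂ)⁻¹) *
      ∫ z, conj (stft ψ (h - (φ : 𝓢'(ℝ, ℂ))) z) * stft ψ f z := by
    have h1 : bracket f φ = (windowEnergy ψ : ℂ)⁻¹ *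
        ∫ z, conj (stft ψ (φ : 𝓢'(ℝ, ℂ)) z) * stft ψ f z := by
      rw [← windowEnergy_mul_bracket, inv_mul_cancel_left₀ hE]
    have h2 : ∫ z, conj (stft ψ (φ : 𝓢'(ℝ, ℂ)) z) * stft ψ f z
        = (∫ z, conj (stft ψ h z) * stft ψ f z)
          - ∫ z, conj (stft ψ (h - (φ : 𝓢'(ℝ, ℂ))) z) * stft ψ f z := by
      rw [← integral_sub (hintegrable h hh) (hintegrable _ hφ)]
      refine integral_congr_ae (Eventually.of_forall fun z => ?_)
      simp only [stft_sub, map_sub]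
      ring
    rw [h1, h2, stftPairing]
    ring
  rw [edist_eq_enorm_sub, hb, mul_assoc]
  refine (enorm_inv_mul_integral_le _).trans ?_
  rw [enorm_neg]
  gcongr
  exact hle _

/-! ### Gabor expansions -/

theorem inner_toLp_eq_integral (χ : 𝓢(ℝ, ℂ)) (h : Lp ℂ 2 (volume : Measure ℝ)) :
    inner ℂ (χ.toLp 2) h = ∫ y, conj (χ y) * h y := by
  rw [L2.inner_def]
  refine integral_congr_ae ?_
  filter_upwards [χ.coeFn_toLp 2] with y hy
  rw [RCLike.inner_apply, hy, mul_comm]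

theorem stft_eq_inner (ψ : 𝓢(ℝ, ℂ)) (h : Lp ℂ 2 (volume : Measure ℝ)) (z : ℝ × ℝ) :
    stft ψ (h : 𝓢'(ℝ, ℂ)) z = inner ℂ ((tfShift z.1 z.2 ψ).toLp 2) h := by
  rw [stft_coe_lp, inner_toLp_eq_integral]

theorem enorm_stft_gabor (ψ : 𝓢(ℝ, ℂ)) (α β : ℝ) (h : Lp ℂ 2 (volume : Measure ℝ)) (i : ℤ × ℤ)
    (z : ℝ × ℝ) :
    ‖stft ψ (gabor α β h i : 𝓢'(ℝ, ℂ)) z‖ₑ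
      = ‖stft ψ (h : 𝓢'(ℝ, ℂ)) (z - latticePoint α β i)‖ₑ := by
  rw [← ofReal_norm, ← ofReal_norm, ← norm_stft_tfShiftL2]
  rfl

theorem modNorm_gabor (ψ : 𝓢(ℝ, ℂ)) (p : ℝ≥0∞) (α β : ℝ) (h : Lp ℂ 2 (volume : Measure ℝ))
    (i : ℤ × ℤ) :
    modNorm ψ p (gabor α β h i : 𝓢'(ℝ, ℂ)) = modNorm ψ p (h : 𝓢'(ℝ, ℂ)) := by
  have h1 : modNorm ψ p (gabor α β h i : 𝓢'(ℝ, ℂ))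
      = eLpNorm (stft ψ (h : 𝓢'(ℝ, ℂ)) ∘ fun z => z - latticePoint α β i) p volume :=
    eLpNorm_congr_enorm_ae (Eventually.of_forall (enorm_stft_gabor ψ α β h i))
  rw [h1, eLpNorm_comp_measurePreserving (continuous_stft ψ _).aestronglyMeasurable
    (measurePreserving_sub_right volume (latticePoint α β i)), modNorm]

/-- A Schauder frame expands the reproducing kernel of the short-time Fourier transform. -/
theorem exists_tendsto_kernel_of_frame {α β : ℝ} {g γ : Lp ℂ 2 (volume : Measure ℝ)}
    (hframe : IsGaborSchauderFrame α β g γ) (ψ : 𝓢(ℝ, ℂ)) :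
    ∃ σ : ℕ ≃ ℤ × ℤ, ∀ z z₀ : ℝ × ℝ, Tendsto (fun N : ℕ => ∑ j ∈ Finset.range N,
      conj (stft ψ (gabor α β γ (σ j) : 𝓢'(ℝ, ℂ)) z) * stft ψ (gabor α β g (σ j) : 𝓢'(ℝ, ℂ)) z₀)
      atTop (𝓝 (stft ψ (tfShift z.1 z.2 ψ : 𝓢'(ℝ, ℂ)) z₀)) := by
  obtain ⟨σ, hσ⟩ := hframe
  refine ⟨σ, fun z z₀ => ?_⟩
  have h := ((innerSL ℂ ((tfShift z₀.1 z₀.2 ψ).toLp 2 (volume : Measure ℝ))).continuous.tendsto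
    _).comp (hσ ((tfShift z.1 z.2 ψ).toLp 2))
  have e : stft ψ (tfShift z.1 z.2 ψ : 𝓢'(ℝ, ℂ)) z₀
      = innerSL ℂ ((tfShift z₀.1 z₀.2 ψ).toLp 2) ((tfShift z.1 z.2 ψ).toLp 2) := by
    rw [innerSL_apply_apply, ← stft_eq_inner, Lp.toTemperedDistribution_toLp_eq]
  rw [e]
  refine h.congr fun N => ?_
  simp only [Function.comp_apply, map_sum, map_smul, innerSL_apply_apply, smul_eq_mul,
    stft_eq_inner, inner_conj_symm]

/-- Finiteness of the triple convolution which controls Gabor expansions. -/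
theorem tsum_lintegral_mul_ne_top {α β : ℝ} (hα : 0 < α) (hβ : 0 < β) {s p r q : ℝ}
    (hs : 1 ≤ s) (hp : 1 ≤ p) (hr : 1 ≤ r) (hq : 1 ≤ q) (h₁ : 1 / r = 1 / s + 1 / p - 1)
    (h₂ : 1 / q = 1 / r + 1 / p - 1) {F H G : ℝ × ℝ → ℝ≥0∞}
    (hF : lpSum s (cellSup α β F) ≠ ∞) (hH : lpSum p (cellSup α β H) ≠ ∞)
    (hG : lpSum p (cellSup α β G) ≠ ∞) (z₀ : ℝ × ℝ) :
    ∑' i, (∫⁻ z, F z * H (z - latticePoint α β i)) * G (z₀ - latticePoint α β i) ≠ ∞ := by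
  set j : ℤ × ℤ := (⌊z₀.1 / α⌋, ⌊z₀.2 / β⌋)
  set d : ℤ × ℤ → ℝ≥0∞ := fun i => ∫⁻ z, F z * H (z - latticePoint α β i)
  have h3 := lpSum_lintegral_mul_translate_le hα hβ hs hp hr h₁ F H
  have h4 : lpSum r d ≠ ∞ := ne_top_of_le_ne_top (by finiteness) h3
  refine ne_top_of_le_ne_top (b := lpSum r d * lpSum p (cellSup α β G)) (by finiteness) ?_
  -- The series at `z₀` is bounded by the entry of a discrete convolution at the cell index `j` of
  -- `z₀`, hence by its `ℓ^q` norm.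
  refine le_trans ?_ ((le_lpSum (by linarith) (fun n => ∑' m, d m * cellSup α β G (n - m)) j).trans
    (lpSum_conv_le hr hp hq h₂ d (cellSup α β G)))
  refine ENNReal.tsum_le_tsum fun i => ?_
  gcongr
  exact le_cellSup G (sub_latticePoint_mem_cell hα hβ (mem_cell_self α β z₀))

theorem enorm_stftPairing_gabor_le (ψ : 𝓢(ℝ, ℂ)) (α β : ℝ) (f : 𝓢'(ℝ, ℂ))
    (γ : Lp ℂ 2 (volume : Measure ℝ)) (i : ℤ × ℤ) :
    ‖stftPairing ψ f (gabor α β γ i : 𝓢'(ℝ, ℂ))‖ₑ ≤ ‖(windowEnergy ψ : ℂ)⁻¹‖ₑ *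
      ∫⁻ z, ‖stft ψ f z‖ₑ * ‖stft ψ (γ : 𝓢'(ℝ, ℂ)) (z - latticePoint α β i)‖ₑ := by
  refine (enorm_inv_mul_integral_le _).trans (le_of_eq ?_)
  simp only [enorm_conj_mul, enorm_stft_gabor]

/-- Pointwise Gabor expansion of the short-time Fourier transform. -/
theorem hasSum_stft_gabor {ψ : 𝓢(ℝ, ℂ)} (hψ : ψ ≠ 0) {α β : ℝ} (hα : 0 < α) (hβ : 0 < β)
    {s p r q : ℝ} (hs : 1 ≤ s) (hp : 1 ≤ p) (hr : 1 ≤ r) (hq : 1 ≤ q)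
    (h₁ : 1 / r = 1 / s + 1 / p - 1) (h₂ : 1 / q = 1 / r + 1 / p - 1)
    {g γ : Lp ℂ 2 (volume : Measure ℝ)}
    (hg : MemModulation ψ (ENNReal.ofReal p) (g : 𝓢'(ℝ, ℂ)))
    (hγ : MemModulation ψ (ENNReal.ofReal p) (γ : 𝓢'(ℝ, ℂ)))
    (hframe : IsGaborSchauderFrame α β g γ)
    {f : 𝓢'(ℝ, ℂ)} (hf : MemModulation ψ (ENNReal.ofReal s) f) (z₀ : ℝ × ℝ) :
    HasSum (fun i => stftPairing ψ f (gabor α β γ i : 𝓢'(ℝ, ℂ)) *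
      stft ψ (gabor α β g i : 𝓢'(ℝ, ℂ)) z₀) (stft ψ f z₀) := by
  have hE : (windowEnergy ψ : ℂ) ≠ 0 := by exact_mod_cast (windowEnergy_pos hψ).ne'
  obtain ⟨σ, hσ⟩ := exists_tendsto_kernel_of_frame hframe ψ
  set T : ℤ × ℤ → ℝ × ℝ → ℂ := fun i z => conj (stft ψ (gabor α β γ i : 𝓢'(ℝ, ℂ)) z) *
    stft ψ (gabor α β g i : 𝓢'(ℝ, ℂ)) z₀ * stft ψ f z with hT
  have hTcont : ∀ i, Continuous (T i) := fun i =>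
    ((Complex.continuous_conj.comp (continuous_stft ψ _)).mul continuous_const).mul
      (continuous_stft ψ f)
  have hfin : ∑' i, ∫⁻ z, ‖T i z‖ₑ ≠ ∞ := by
    refine ne_of_eq_of_ne ?_ (tsum_lintegral_mul_ne_top hα hβ hs hp hr hq h₁ h₂
      (lpSum_cellSup_stft_ne_top hψ hα hβ hs hf) (lpSum_cellSup_stft_ne_top hψ hα hβ hp hγ)
      (lpSum_cellSup_stft_ne_top hψ hα hβ hp hg) z₀)
    refine tsum_congr fun i => ?_
    rw [← lintegral_mul_const' _ _ enorm_ne_top]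
    refine lintegral_congr fun z => ?_
    rw [hT, enorm_mul, enorm_mul, RCLike.enorm_conj, enorm_stft_gabor, enorm_stft_gabor]
    ring
  have hTint : ∀ i, (windowEnergy ψ : ℂ)⁻¹ * ∫ z, T i z
      = stftPairing ψ f (gabor α β γ i : 𝓢'(ℝ, ℂ)) * stft ψ (gabor α β g i : 𝓢'(ℝ, ℂ)) z₀ := by
    intro i
    rw [stftPairing, mul_assoc, ← integral_mul_const]
    congr 2
    funext z
    simp only [hT]
    ring
  have hsumm : Summable fun i => ∫ z, T i z :=
    Summable.of_enorm (ne_top_of_le_ne_top hfin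
      (ENNReal.tsum_le_tsum fun i => enorm_integral_le_lintegral_enorm _))
  -- For almost every `z` the series converges absolutely, so its unordered sum agrees with the
  -- limit along the frame's enumeration `σ`.
  have htsum : ∀ᵐ z, ∑' i, T i z = stft ψ (tfShift z.1 z.2 ψ : 𝓢'(ℝ, ℂ)) z₀ * stft ψ f z := by
    have hmeas : ∀ i, AEMeasurable (fun z => ‖T i z‖ₑ) := fun i =>
      (hTcont i).enorm.measurable.aemeasurable
    rw [← lintegral_tsum hmeas] at hfin
    filter_upwards [ae_lt_top' (AEMeasurable.tsum hmeas) hfin] with z hz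
    have h3 := ((Equiv.hasSum_iff σ).2 (Summable.of_enorm hz.ne).hasSum).tendsto_sum_nat
    refine tendsto_nhds_unique h3 ?_
    simpa only [hT, Finset.sum_mul, Function.comp_def] using (hσ z z₀).mul_const (stft ψ f z)
  have hmain : stft ψ f z₀ = (windowEnergy ψ : ℂ)⁻¹ * ∑' i, ∫ z, T i z := by
    rw [← integral_tsum (fun i => (hTcont i).aestronglyMeasurable) hfin,
      integral_congr_ae htsum, ← inv_windowEnergy_mul_integral hψ]
  rw [hmain]
  simpa only [hTint] using hsumm.hasSum.mul_left (windowEnergy ψ : ℂ)⁻¹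

/-- The synthesis bound: on cell `n` the `i`-th translate of `G` is at most its supremum over cell
`n - i`, and Young applies. -/
theorem modNorm_le_of_enorm_stft_le {ψ : 𝓢(ℝ, ℂ)} {α β : ℝ} (hα : 0 < α) (hβ : 0 < β)
    {p r q : ℝ} (hp : 1 ≤ p) (hr : 1 ≤ r) (hq : 1 ≤ q) (h : 1 / q = 1 / r + 1 / p - 1)
    {f : 𝓢'(ℝ, ℂ)} {d : ℤ × ℤ → ℝ≥0∞} {G : ℝ × ℝ → ℝ≥0∞}
    (hle : ∀ z, ‖stft ψ f z‖ₑ ≤ ∑' i, d i * G (z - latticePoint α β i)) :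
    modNorm ψ (ENNReal.ofReal q) f ≤ (ENNReal.ofReal α * ENNReal.ofReal β) ^ (1 / q) *
      (lpSum r d * lpSum p (cellSup α β G)) := by
  refine (modNorm_le_lpSum hα hβ (by linarith) (a := fun n => ∑' m, d m * cellSup α β G (n - m))
    fun i z hz => (hle z).trans ?_).trans ?_
  · refine ENNReal.tsum_le_tsum fun m => ?_
    gcongr
    exact le_cellSup G (sub_latticePoint_mem_cell hα hβ hz)
  · gcongr
    exact lpSum_conv_le hr hp hq h d (cellSup α β G)

theorem tendsto_lpSum_compl_zero {ι : Type*} [DecidableEq ι] {r : ℝ} (hr : 0 < r)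
    {d : ι → ℝ≥0∞} (hd : lpSum r d ≠ ∞) (σ : ℕ ≃ ι) :
    Tendsto (fun N : ℕ => lpSum r fun i =>
      if i ∈ (Finset.range N).map σ.toEmbedding then 0 else d i) atTop (𝓝 0) := by
  have hfin : ∑' i, d i ^ r ≠ ∞ := by
    intro h
    exact hd (by rw [lpSum, h, ENNReal.top_rpow_of_pos (by positivity)])
  have hs : Tendsto (fun N : ℕ => (Finset.range N).map σ.toEmbedding) atTop atTop := by
    refine tendsto_atTop_finset_of_monotone (fun M N h => ?_) fun i => ⟨σ.symm i + 1, ?_⟩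
    · exact Finset.map_subset_map.2 (Finset.range_mono h)
    · rw [Finset.mem_map_equiv]
      simp
  have h1 := (ENNReal.tendsto_tsum_compl_atTop_zero hfin).comp hs
  have h2 := (ENNReal.continuous_rpow_const (y := 1 / r)).tendsto 0
  rw [ENNReal.zero_rpow_of_pos (by positivity)] at h2
  refine (h2.comp h1).congr fun N => ?_
  simp only [Function.comp_apply, lpSum]
  congr 1
  refine (tsum_subtype {i | i ∉ (Finset.range N).map σ.toEmbedding} (fun i => d i ^ r)).trans
    (tsum_congr fun i => ?_)
  by_cases hi : i ∈ (Finset.range N).map σ.toEmbedding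
  · rw [if_pos hi, ENNReal.zero_rpow_of_pos hr, Set.indicator_of_notMem (by simpa using hi)]
  · rw [if_neg hi, Set.indicator_of_mem (by simpa using hi)]

/-- A Gabor expansion which holds pointwise on the side of short-time Fourier transforms and has
`r`-summable coefficients converges unconditionally in a modulation space. -/
theorem hasUncondSum_of_hasSum_stft {ψ : 𝓢(ℝ, ℂ)} {α β : ℝ} (hα : 0 < α) (hβ : 0 < β)
    {p r q : ℝ} (hp : 1 ≤ p) (hr : 1 ≤ r) (hq : 1 ≤ q) (h : 1 / q = 1 / r + 1 / p - 1)
    {g : Lp ℂ 2 (volume : Measure ℝ)}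
    (hg : lpSum p (cellSup α β fun z => ‖stft ψ (g : 𝓢'(ℝ, ℂ)) z‖ₑ) ≠ ∞)
    {c : ℤ × ℤ → ℂ} (hc : lpSum r (fun i => ‖c i‖ₑ) ≠ ∞) {f : 𝓢'(ℝ, ℂ)}
    (hsum : ∀ z, HasSum (fun i => c i * stft ψ (gabor α β g i : 𝓢'(ℝ, ℂ)) z) (stft ψ f z)) :
    HasUncondSum ψ (ENNReal.ofReal q) (fun i => c i • (gabor α β g i : 𝓢'(ℝ, ℂ))) f := by
  classical
  have hr0 : 0 < r := by linarith
  set v := (ENNReal.ofReal α * ENNReal.ofReal β) ^ (1 / q)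
  have hv : v ≠ ∞ := ENNReal.rpow_ne_top_of_nonneg (by positivity) (by finiteness)
  set G : ℝ × ℝ → ℝ≥0∞ := fun z => ‖stft ψ (g : 𝓢'(ℝ, ℂ)) z‖ₑ with hG
  have hterm : ∀ i z, ‖c i * stft ψ (gabor α β g i : 𝓢'(ℝ, ℂ)) z‖ₑ
      = ‖c i‖ₑ * G (z - latticePoint α β i) := fun i z => by
    rw [enorm_mul, enorm_stft_gabor]
  -- The remainder after `S` is again an expansion, with the coefficients in `S` set to zero.
  have hrem : ∀ S : Finset (ℤ × ℤ),
      modNorm ψ (ENNReal.ofReal q) (f - ∑ i ∈ S, c i • (gabor α β g i : 𝓢'(ℝ, ℂ)))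
        ≤ v * (lpSum r (fun i => if i ∈ S then 0 else ‖c i‖ₑ) * lpSum p (cellSup α β G)) := by
    intro S
    refine modNorm_le_of_enorm_stft_le hα hβ hp hr hq h fun z => ?_
    have h1 : HasSum (fun i => if i ∈ S then 0 else c i * stft ψ (gabor α β g i : 𝓢'(ℝ, ℂ)) z)
        (stft ψ (f - ∑ i ∈ S, c i • (gabor α β g i : 𝓢'(ℝ, ℂ))) z) := by
      rw [stft_sub, stft_sum]
      have h2 : HasSum (fun i => if i ∈ S then c i * stft ψ (gabor α β g i : 𝓢'(ℝ, ℂ)) z else 0)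
          (∑ i ∈ S, stft ψ (c i • (gabor α β g i : 𝓢'(ℝ, ℂ))) z) := by
        rw [Finset.sum_congr rfl fun i (hi : i ∈ S) =>
          (stft_smul ψ (c i) (gabor α β g i : 𝓢'(ℝ, ℂ)) z).trans (if_pos hi).symm]
        exact hasSum_sum_of_ne_finset_zero fun i hi => if_neg hi
      have h3 : (fun i => if i ∈ S then 0 else c i * stft ψ (gabor α β g i : 𝓢'(ℝ, ℂ)) z)
          = fun i => c i * stft ψ (gabor α β g i : 𝓢'(ℝ, ℂ)) z -
            if i ∈ S then c i * stft ψ (gabor α β g i : 𝓢'(ℝ, ℂ)) z else 0 := by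
        funext i
        split_ifs <;> simp
      rw [h3]
      exact (hsum z).sub h2
    rw [← h1.tsum_eq]
    refine enorm_tsum_le_tsum_enorm.trans (ENNReal.tsum_le_tsum fun i => ?_)
    by_cases hi : i ∈ S
    · simp [hi]
    · simp only [if_neg hi, hterm]
      exact le_rfl
  refine ⟨?_, fun i => ?_, fun σ => ?_⟩
  · have h0 := hrem ∅
    simp only [Finset.sum_empty, sub_zero, Finset.notMem_empty, if_false] at h0
    exact h0.trans_lt (Ne.lt_top (by finiteness))
  · have h1 : modNorm ψ (ENNReal.ofReal q) (c i • (gabor α β g i : 𝓢'(ℝ, ℂ)))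
        ≤ v * (lpSum r (fun j => if j = i then ‖c j‖ₑ else 0) * lpSum p (cellSup α β G)) := by
      refine modNorm_le_of_enorm_stft_le hα hβ hp hr hq h fun z => ?_
      rw [stft_smul, hterm]
      refine le_trans (le_of_eq ?_) (ENNReal.le_tsum i)
      rw [if_pos rfl]
    have h2 : lpSum r (fun j => if j = i then ‖c j‖ₑ else 0) ≠ ∞ :=
      ne_top_of_le_ne_top hc (lpSum_mono hr0.le fun j => by split_ifs <;> simp)
    exact h1.trans_lt (Ne.lt_top (by finiteness))
  · have h1 := tendsto_lpSum_compl_zero hr0 hc σ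
    have h2 := ENNReal.Tendsto.const_mul (a := v) (ENNReal.Tendsto.mul_const
      (b := lpSum p (cellSup α β G)) h1 (Or.inr hg)) (Or.inr hv)
    rw [zero_mul, mul_zero] at h2
    refine tendsto_of_tendsto_of_tendsto_of_le_of_le tendsto_const_nhds h2 (fun _ => zero_le)
      fun N => ?_
    have h3 := hrem ((Finset.range N).map σ.toEmbedding)
    rwa [Finset.sum_map] at h3

/-! ### Exponents and conclusion -/

theorem IsExtensiblePair.denominator_pos {p p₁ : ℝ} (h : IsExtensiblePair p p₁) :
    0 < p + 2 * p₁ - 2 * p * p₁ := by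
  obtain ⟨hp, -, hp₁, rfl | h⟩ := h
  · linarith
  · rcases hp.eq_or_lt with rfl | hp'
    · linarith
    · rw [lt_div_iff₀ (by linarith)] at h
      linarith

theorem mainTheorem7 (ψ : 𝓢(ℝ, ℂ)) (hψ : ψ ≠ 0)
    (α β : ℝ) (hα : 0 < α) (hβ : 0 < β)
    (p p₁ : ℝ) (hp : IsExtensiblePair p p₁)
    (g γ : Lp ℂ 2 (volume : Measure ℝ))
    (hg : MemModulation ψ (ENNReal.ofReal p) (g : 𝓢'(ℝ, ℂ)))
    (hγ : MemModulation ψ (ENNReal.ofReal p) (γ : 𝓢'(ℝ, ℂ)))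
    (hframe : IsGaborSchauderFrame α β g γ)
    (f : 𝓢'(ℝ, ℂ)) (hf : MemModulation ψ (ENNReal.ofReal p₁) f) :
    (∀ i : ℤ × ℤ, PairingExists ψ (ENNReal.ofReal p) f (gabor α β γ i : 𝓢'(ℝ, ℂ))) ∧
      HasUncondSum ψ (ENNReal.ofReal (p * p₁ / (p + 2 * p₁ - 2 * p * p₁)))
        (fun i => dualPairing ψ (ENNReal.ofReal p) f (gabor α β γ i : 𝓢'(ℝ, ℂ)) •
          (gabor α β g i : 𝓢'(ℝ, ℂ))) f := by
  have hD := hp.denominator_pos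
  obtain ⟨hp1, -, hs1, -⟩ := hp
  have hp0 : 0 < p := by linarith
  have hs0 : 0 < p₁ := by linarith
  have hpp : 1 ≤ p * p₁ := one_le_mul_of_one_le_of_one_le hp1 hs1
  have hle₁ : p ≤ p * p₁ := le_mul_of_one_le_right hp0.le hs1
  have hle₂ : p₁ ≤ p * p₁ := le_mul_of_one_le_left hs0.le hp1
  have hR : 0 < p + p₁ - p * p₁ := by linarith
  -- `r` is the exponent of the coefficient sequence, intermediate between `p₁` and `q`.
  set r : ℝ := p * p₁ / (p + p₁ - p * p₁) with hr
  set q : ℝ := p * p₁ / (p + 2 * p₁ - 2 * p * p₁) with hq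
  have hr1 : 1 ≤ r := by
    rw [hr, one_le_div hR]
    linarith [mul_nonneg (sub_nonneg.2 hp1) (sub_nonneg.2 hs1)]
  have hq1 : 1 ≤ q := by
    rw [hq, one_le_div hD]
    linarith
  have e₁ : 1 / r = 1 / p₁ + 1 / p - 1 := by
    rw [hr]
    field_simp
  have e₂ : 1 / q = 1 / r + 1 / p - 1 := by
    rw [hq, hr]
    field_simp
    ring
  have hγi : ∀ i, MemModulation ψ (ENNReal.ofReal p) (gabor α β γ i : 𝓢'(ℝ, ℂ)) := fun i => by
    rw [MemModulation, modNorm_gabor]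
    exact hγ
  have hne : ∀ i, (schwartzApprox ψ (ENNReal.ofReal p) (gabor α β γ i : 𝓢'(ℝ, ℂ))).NeBot :=
    fun i => schwartzApprox_neBot hψ hp1 (hγi i)
  have hlim : ∀ i, Tendsto (bracket f)
      (schwartzApprox ψ (ENNReal.ofReal p) (gabor α β γ i : 𝓢'(ℝ, ℂ)))
      (𝓝 (stftPairing ψ f (gabor α β γ i : 𝓢'(ℝ, ℂ)))) :=
    fun i => tendsto_bracket_schwartzApprox hψ hs1 hp1 hr1 e₁ hf (hγi i)
  refine ⟨fun i => ⟨hne i, _, hlim i⟩, ?_⟩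
  have hdual : ∀ i, dualPairing ψ (ENNReal.ofReal p) f (gabor α β γ i : 𝓢'(ℝ, ℂ))
      = stftPairing ψ f (gabor α β γ i : 𝓢'(ℝ, ℂ)) := fun i => by
    -- Provides the `NeBot` instance that makes the limit unique.
    have := hne i
    exact (hlim i).limUnder_eq
  simp only [hdual]
  have hF := lpSum_cellSup_stft_ne_top hψ hα hβ hs1 hf
  have hΓ := lpSum_cellSup_stft_ne_top hψ hα hβ hp1 hγ
  refine hasUncondSum_of_hasSum_stft hα hβ hp1 hr1 hq1 e₂
    (lpSum_cellSup_stft_ne_top hψ hα hβ hp1 hg) ?_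
    (hasSum_stft_gabor hψ hα hβ hs1 hp1 hr1 hq1 e₁ e₂ hg hγ hframe hf)
  refine ne_top_of_le_ne_top ?_ (lpSum_mono (by linarith)
    (enorm_stftPairing_gabor_le ψ α β f γ))
  rw [lpSum_const_mul (by linarith)]
  have h3 := ne_top_of_le_ne_top (by finiteness)
    (lpSum_lintegral_mul_translate_le hα hβ hs1 hp1 hr1 e₁ (fun z => ‖stft ψ f z‖ₑ)
      (fun z => ‖stft ψ (γ : 𝓢'(ℝ, ℂ)) z‖ₑ))
  finiteness
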